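/- Let $\mathbb{k}$ be a field and let $G$ be a finite abelian group which has square roots, i.e. for every $g\in G$ there is $h\in G$ with $h^2=g$ (equivalently, $|G|$ is odd; square roots in $G$ are then unique). For $q:G\to\mathbb{k}^\times$ put $\beta_q(g,h)=q(gh)q(g)^{-1}q(h)^{-1}$. A quadratic form is a map $q:G\to\mathbb{k}^\times$ with $q(g)=q(g^{-1})$ such that $\beta_q$ is a bihomomorphism. Let $\mathrm{WRQF}(G,\mathbb{k}^\times)$ be the set of triples $(q,\eta,g_0)$ consisting of a quadratic form $q$, a character $\eta:G\to\mathbb{k}^\times$ and $g_0\in G$ with $\eta(g)=\beta_q(g,g_0)$ for all $g\in G$; write $(q,\eta,g_0)\sim(q',\eta',g_0')$ if there is $f\in\mathrm{Aut}(G)$ with $q\eta=f^*(q'\eta')$ and $f(g_0)=g_0'$. A normalized abelian 3-cocycle is a pair $(\psi,\Omega)$ of maps $\psi:G^3\to\mathbb{k}^\times$, $\Omega:G^2\to\mathbb{k}^\times$, each equal to $1$ whenever one of its arguments is $1$, such that for all $g_i\in G$ $$\psi(g_2,g_3,g_4)\,\psi(g_1g_2,g_3,g_4)^{-1}\,\psi(g_1,g_2g_3,g_4)\,\psi(g_1,g_2,g_3g_4)^{-1}\,\psi(g_1,g_2,g_3)=1,$$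 $$\psi(g_2,g_3,g_1)^{-1}\,\Omega(g_1,g_2g_3)\,\psi(g_1,g_2,g_3)^{-1}=\Omega(g_1,g_3)\,\psi(g_2,g_1,g_3)^{-1}\,\Omega(g_1,g_2),$$ $$\psi(g_3,g_1,g_2)\,\Omega(g_1g_2,g_3)\,\psi(g_1,g_2,g_3)=\Omega(g_1,g_3)\,\psi(g_1,g_3,g_2)\,\Omega(g_2,g_3).$$ Its EM-image is the map $g\mapsto\Omega(g,g)$. Let $G\text{-}\mathsf{vect}_{\mathbb{k}}$ be the category of finite-dimensional $G$-graded vector spaces with the tensor product $(V\otimes W)_g=\bigoplus_{hk=g}V_h\otimes W_k$, unit object $\mathbb{k}=\mathbb{k}_1$, and the usual unitors $\lambda,\varrho$; here $\mathbb{k}_g$ is the simple object with $\mathbb{k}$ in degree $g$ and basis vector $1_g$. For $g_0\in G$ let $(-)^{g_0}$ be the contravariant functor with $(V^{g_0})_g=(V_{g^{-1}g_0})^*$, acting on morphisms by transposition; it is the $\star$-autonomous duality with dualizing object $\mathbb{k}_{g_0}$. Let $\mathrm{WRMS}(G,\mathbb{k})$ be the class of quadruples $(\alpha,\gamma,\theta,g_0)$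 where $g_0\in G$ and $\alpha_{X,Y,Z}:(X\otimes Y)\otimes Z\cong X\otimes(Y\otimes Z)$, $\gamma_{X,Y}:X\otimes Y\cong Y\otimes X$, $\theta_X:X\cong X$ are natural isomorphisms such that $(\otimes,\mathbb{k},\alpha,\lambda,\varrho,\gamma)$ is a braided monoidal structure on $G\text{-}\mathsf{vect}_{\mathbb{k}}$, $\theta_{X\otimes Y}=(\theta_X\otimes\theta_Y)\circ\gamma_{Y,X}\circ\gamma_{X,Y}$, and $(\theta_X)^{g_0}=\theta_{X^{g_0}}$ for all $X,Y$. Write $(\alpha,\gamma,\theta,g_0)\sim(\alpha',\gamma',\theta',g_0')$ if there is a $\mathbb{k}$-linear braided strong monoidal equivalence $F$ from $G\text{-}\mathsf{vect}_{\mathbb{k}}$ with $(\alpha,\gamma)$ to $G\text{-}\mathsf{vect}_{\mathbb{k}}$ with $(\alpha',\gamma')$ such that $F(\theta_{\mathbb{k}_g})=\theta'_{F(\mathbb{k}_g)}$ for all $g\in G$ and $F$ preserves the dualizing objects, $F(\mathbb{k}_{g_0})\cong\mathbb{k}_{g_0'}$. For maps $\psi:G^3\to\mathbb{k}^\times$,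 $\Omega:G^2\to\mathbb{k}^\times$, $t:G\to\mathbb{k}^\times$ let $\alpha_\psi,\gamma_\Omega,\theta_t$ be the natural isomorphisms which on simple objects are $(1_{g_1}\otimes1_{g_2})\otimes1_{g_3}\mapsto\psi(g_1,g_2,g_3)\,1_{g_1}\otimes(1_{g_2}\otimes1_{g_3})$, $1_{g_1}\otimes1_{g_2}\mapsto\Omega(g_2,g_1)\,1_{g_2}\otimes1_{g_1}$ and $1_g\mapsto t(g)1_g$. Theorem. For every quadratic form $q$ occurring in some $(q,\eta,g_0)\in\mathrm{WRQF}(G,\mathbb{k}^\times)$ there is a normalized abelian 3-cocycle $(\psi_q,\Omega_q)$ with EM-image $q$, and for every such cocycle $(\alpha_{\psi_q},\gamma_{\Omega_q},\theta_{q\eta},g_0^{-2})\in\mathrm{WRMS}(G,\mathbb{k})$. The assignment $$[(q,\eta,g_0)]\longmapsto[(\alpha_{\psi_q},\gamma_{\Omega_q},\theta_{q\eta},g_0^{-2})]$$ is well defined (independent of the representative and of the chosen cocycle) and is a bijection $\mathrm{WRQF}(G,\mathbb{k}^\times)/{\sim}\;\to\;\mathrm{WRMS}(G,\mathbb{k})/{\sim}$.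 -/

import Mathlib

open CategoryTheory MonoidalCategory

universe u

/-! ## Quadratic forms and abelian 3-cocycles -/

section QuadraticForms

variable {k G : Type u} [Field k] [CommGroup G]

/-- The function `β_q (g, h) = q (g h) q(g)⁻¹ q(h)⁻¹` associated with `q : G → kˣ`. -/
def assocForm (q : G → kˣ) (g h : G) : kˣ := q (g * h) * (q g)⁻¹ * (q h)⁻¹

variable (k G)

/-- Quadratic forms on `G` with values in `kˣ`. -/
@[ext]
structure QuadForm where
  toFun : G → kˣ
  symm : ∀ g, toFun g = toFun g⁻¹
  bihom_left : ∀ a b c, assocForm toFun (a * b) c = assocForm toFun a c * assocForm toFun b c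
  bihom_right : ∀ a b c, assocForm toFun a (b * c) = assocForm toFun a b * assocForm toFun a c

/-- Weak representable quadratic forms `(q, η, g₀)`: a quadratic form `q`, a character `η` and an
element `g₀` with `η(g) = β_q(g, g₀)` for all `g`. -/
@[ext]
structure WRQF where
  q : QuadForm k G
  η : G →* kˣ
  pt : G
  represents : ∀ g, η g = assocForm q.toFun g pt

variable {k G}

/-- The function `q η`. -/
def WRQF.total (x : WRQF k G) (g : G) : kˣ := x.q.toFun g * x.η g

variable (k G)

/-- `(q, η, g₀) ~ (q', η', g₀')` iff there is `f ∈ Aut(G)` with `q η = f^*(q' η')` and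
`f(g₀) = g₀'`. -/
instance WRQF.setoid : Setoid (WRQF k G) where
  r x y := ∃ f : G ≃* G, (∀ g, x.total g = y.total (f g)) ∧ f x.pt = y.pt
  iseqv :=
    { refl := fun _ => ⟨MulEquiv.refl G, fun _ => rfl, rfl⟩
      symm := by
        rintro x y ⟨f, h, h'⟩
        exact ⟨f.symm, fun g => by simp [h], by simp [← h']⟩
      trans := by
        rintro x y z ⟨f, h, h'⟩ ⟨f₁, h₁, h₁'⟩
        exact ⟨f.trans f₁, fun g => by simp [h, h₁], by simp [h', h₁']⟩ }

/-- Normalized abelian 3-cocycles `(ψ, Ω)` on `G` with values in `kˣ`. -/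
structure AbelianCocycle where
  ψ : G → G → G → kˣ
  Ω : G → G → kˣ
  ψ_one_left : ∀ g h, ψ 1 g h = 1
  ψ_one_mid : ∀ g h, ψ g 1 h = 1
  ψ_one_right : ∀ g h, ψ g h 1 = 1
  Ω_one_left : ∀ g, Ω 1 g = 1
  Ω_one_right : ∀ g, Ω g 1 = 1
  /-- `dψ = 1` -/
  coboundary_eq_one : ∀ g₁ g₂ g₃ g₄,
    ψ g₂ g₃ g₄ * (ψ (g₁ * g₂) g₃ g₄)⁻¹ * ψ g₁ (g₂ * g₃) g₄ * (ψ g₁ g₂ (g₃ * g₄))⁻¹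
      * ψ g₁ g₂ g₃ = 1
  cocycle_left : ∀ g₁ g₂ g₃,
    (ψ g₂ g₃ g₁)⁻¹ * Ω g₁ (g₂ * g₃) * (ψ g₁ g₂ g₃)⁻¹ =
      Ω g₁ g₃ * (ψ g₂ g₁ g₃)⁻¹ * Ω g₁ g₂
  cocycle_right : ∀ g₁ g₂ g₃,
    ψ g₃ g₁ g₂ * Ω (g₁ * g₂) g₃ * ψ g₁ g₂ g₃ = Ω g₁ g₃ * ψ g₁ g₃ g₂ * Ω g₂ g₃

variable {k G}

/-- The Eilenberg-MacLane image `q_Ω(g) = Ω(g, g)` of an abelian 3-cocycle `(ψ, Ω)`. -/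
def AbelianCocycle.emImage (c : AbelianCocycle k G) (g : G) : kˣ := c.Ω g g

end QuadraticForms

/-! ## The category of finite-dimensional graded vector spaces -/

section GradedVectorSpaces

/-- A finite-dimensional `G`-graded `k`-vector space, given by its homogeneous components. -/
structure GVect (k G : Type u) [Field k] where
  comp : G → Type u
  [addCommGroup : ∀ g, AddCommGroup (comp g)]
  [module : ∀ g, Module k (comp g)]
  [finite : ∀ g, Module.Finite k (comp g)]

namespace GVect

attribute [instance] GVect.addCommGroup GVect.module GVect.finite

open TensorProduct DirectSum

variable {k G : Type u} [Field k]

/-- Degree-preserving linear maps. -/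
@[ext]
structure Hom (V W : GVect k G) where
  app : ∀ g, V.comp g →ₗ[k] W.comp g

instance : Category (GVect k G) where
  Hom := Hom
  id _ := ⟨fun _ => LinearMap.id⟩
  comp f f' := ⟨fun g => f'.app g ∘ₗ f.app g⟩

@[ext]
theorem hom_ext {V W : GVect k G} {f f' : V ⟶ W} (h : ∀ g, f.app g = f'.app g) : f = f' :=
  Hom.ext (funext h)

@[simp] theorem id_app (V : GVect k G) (g : G) : Hom.app (𝟙 V) g = LinearMap.id := rfl

@[simp] theorem comp_app {V W U : GVect k G} (f : V ⟶ W) (f' : W ⟶ U) (g : G) :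
    (f ≫ f').app g = f'.app g ∘ₗ f.app g := rfl

section Linear

variable {V W : GVect k G}

instance : Zero (V ⟶ W) := ⟨⟨fun _ => 0⟩⟩
instance : Add (V ⟶ W) := ⟨fun f f' => ⟨fun g => f.app g + f'.app g⟩⟩
instance : Neg (V ⟶ W) := ⟨fun f => ⟨fun g => -f.app g⟩⟩
instance : Sub (V ⟶ W) := ⟨fun f f' => ⟨fun g => f.app g - f'.app g⟩⟩
instance : SMul k (V ⟶ W) := ⟨fun r f => ⟨fun g => r • f.app g⟩⟩
instance : SMul ℕ (V ⟶ W) := ⟨fun r f => ⟨fun g => r • f.app g⟩⟩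
instance : SMul ℤ (V ⟶ W) := ⟨fun r f => ⟨fun g => r • f.app g⟩⟩

theorem app_injective :
    Function.Injective (fun (f : V ⟶ W) => (fun g => f.app g : ∀ g, V.comp g →ₗ[k] W.comp g)) :=
  fun _ _ h => hom_ext (congrFun h)

instance : AddCommGroup (V ⟶ W) :=
  app_injective.addCommGroup _ rfl (fun _ _ => rfl) (fun _ => rfl) (fun _ _ => rfl)
    (fun _ _ => rfl) (fun _ _ => rfl)

instance : Module k (V ⟶ W) :=
  app_injective.module k
    ({ toFun := _, map_zero' := rfl, map_add' := fun _ _ => rfl } :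
      (V ⟶ W) →+ (∀ g, V.comp g →ₗ[k] W.comp g)) (fun _ _ => rfl)

@[simp] theorem add_app (f f' : V ⟶ W) (g : G) : (f + f').app g = f.app g + f'.app g := rfl
@[simp] theorem smul_app (r : k) (f : V ⟶ W) (g : G) : (r • f).app g = r • f.app g := rfl

instance : Preadditive (GVect k G) where
  add_comp _ _ _ _ _ _ := by ext; simp
  comp_add _ _ _ _ _ _ := by ext; simp

instance : CategoryTheory.Linear k (GVect k G) where
  smul_comp _ _ _ _ _ _ := by ext; simp
  comp_smul _ _ _ _ _ _ := by ext; simp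

end Linear


/-! ### Tensor product -/

section Tensor

variable [CommGroup G] [Finite G]

/-- Pairs of degrees with product `g`. -/
abbrev Pairs (g : G) := {p : G × G // p.1 * p.2 = g}

/-- The tensor product `(V ⊗ W)_g = ⨁_{h l = g} V_h ⊗ W_l`. -/
noncomputable def tensor (V W : GVect k G) : GVect k G where
  comp g := ⨁ p : Pairs g, V.comp p.1.1 ⊗[k] W.comp p.1.2

open scoped Classical in
/-- The inclusion of `V_h ⊗ W_l` into the component of degree `g = h l` of `V ⊗ W`. -/
noncomputable def incl (V W : GVect k G) (h l : G) {g : G} (e : h * l = g) :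
    V.comp h ⊗[k] W.comp l →ₗ[k] (tensor V W).comp g :=
  DirectSum.lof k (Pairs g) (fun p => V.comp p.1.1 ⊗[k] W.comp p.1.2) ⟨(h, l), e⟩

open scoped Classical in
/-- The linear map out of a component of `V ⊗ W` with prescribed restrictions to the summands. -/
noncomputable def desc {V W : GVect k G} {g : G} {M : Type u} [AddCommGroup M] [Module k M]
    (φ : ∀ h l : G, h * l = g → (V.comp h ⊗[k] W.comp l →ₗ[k] M)) :
    (tensor V W).comp g →ₗ[k] M :=
  DirectSum.toModule k (Pairs g) M (fun p => φ p.1.1 p.1.2 p.2)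

@[simp] theorem desc_incl {V W : GVect k G} {g : G} {M : Type u} [AddCommGroup M] [Module k M]
    (φ : ∀ h l : G, h * l = g → (V.comp h ⊗[k] W.comp l →ₗ[k] M)) (h l : G) (e : h * l = g)
    (t : V.comp h ⊗[k] W.comp l) : desc φ (incl V W h l e t) = φ h l e t := by
  classical
  exact DirectSum.toModule_lof (M := fun p : Pairs g => V.comp p.1.1 ⊗[k] W.comp p.1.2)
    (φ := fun p => φ p.1.1 p.1.2 p.2) k (⟨(h, l), e⟩ : Pairs g) t

theorem tensor_ext {V W : GVect k G} {g : G} {M : Type u} [AddCommGroup M] [Module k M]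
    {f f' : (tensor V W).comp g →ₗ[k] M}
    (H : ∀ (h l : G) (e : h * l = g) (v : V.comp h) (w : W.comp l),
      f (incl V W h l e (v ⊗ₜ w)) = f' (incl V W h l e (v ⊗ₜ w))) : f = f' := by
  classical
  refine DirectSum.linearMap_ext (M := fun p : Pairs g => V.comp p.1.1 ⊗[k] W.comp p.1.2) _
    fun p => TensorProduct.ext' fun v w => ?_
  exact H p.1.1 p.1.2 p.2 v w

theorem tensor_ext_left {V W : GVect k G} {a : G} {U M : Type u} [AddCommGroup U] [Module k U]
    [AddCommGroup M] [Module k M] {f f' : (tensor V W).comp a ⊗[k] U →ₗ[k] M}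
    (H : ∀ (h l : G) (e : h * l = a) (v : V.comp h) (w : W.comp l) (u : U),
      f (incl V W h l e (v ⊗ₜ w) ⊗ₜ u) = f' (incl V W h l e (v ⊗ₜ w) ⊗ₜ u)) : f = f' := by
  have : TensorProduct.curry f = TensorProduct.curry f' :=
    tensor_ext fun h l e v w => LinearMap.ext fun u => H h l e v w u
  exact TensorProduct.ext this

theorem tensor_ext_right {V W : GVect k G} {a : G} {U M : Type u} [AddCommGroup U] [Module k U]
    [AddCommGroup M] [Module k M] {f f' : U ⊗[k] (tensor V W).comp a →ₗ[k] M}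
    (H : ∀ (h l : G) (e : h * l = a) (v : V.comp h) (w : W.comp l) (u : U),
      f (u ⊗ₜ incl V W h l e (v ⊗ₜ w)) = f' (u ⊗ₜ incl V W h l e (v ⊗ₜ w))) : f = f' := by
  have : (TensorProduct.curry f).flip = (TensorProduct.curry f').flip :=
    tensor_ext fun h l e v w => LinearMap.ext fun u => H h l e v w u
  exact TensorProduct.ext (LinearMap.flip_inj this)

theorem hom_ext_tensor {V W X : GVect k G} {f f' : tensor V W ⟶ X}
    (H : ∀ (g h l : G) (e : h * l = g) (v : V.comp h) (w : W.comp l),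
      f.app g (incl V W h l e (v ⊗ₜ w)) = f'.app g (incl V W h l e (v ⊗ₜ w))) : f = f' :=
  hom_ext fun g => tensor_ext (H g)

theorem hom_ext_tensor_left {V W U X : GVect k G} {f f' : tensor (tensor V W) U ⟶ X}
    (H : ∀ (g h l c : G) (e : h * l * c = g) (v : V.comp h) (w : W.comp l) (u : U.comp c),
      f.app g (incl _ U (h * l) c e (incl V W h l rfl (v ⊗ₜ w) ⊗ₜ u)) =
        f'.app g (incl _ U (h * l) c e (incl V W h l rfl (v ⊗ₜ w) ⊗ₜ u))) : f = f' := by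
  refine hom_ext_tensor fun g a c e t u => ?_
  have : f.app g ∘ₗ incl (tensor V W) U a c e = f'.app g ∘ₗ incl (tensor V W) U a c e :=
    tensor_ext_left fun h l e' v w u => by subst e'; exact H g h l c e v w u
  exact LinearMap.congr_fun this (t ⊗ₜ u)

theorem hom_ext_tensor_right {V W U X : GVect k G} {f f' : tensor V (tensor W U) ⟶ X}
    (H : ∀ (g h l c : G) (e : h * (l * c) = g) (v : V.comp h) (w : W.comp l) (u : U.comp c),
      f.app g (incl V _ h (l * c) e (v ⊗ₜ incl W U l c rfl (w ⊗ₜ u))) =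
        f'.app g (incl V _ h (l * c) e (v ⊗ₜ incl W U l c rfl (w ⊗ₜ u)))) : f = f' := by
  refine hom_ext_tensor fun g h b e v t => ?_
  have : f.app g ∘ₗ incl V (tensor W U) h b e = f'.app g ∘ₗ incl V (tensor W U) h b e :=
    tensor_ext_right fun l c e' w u v => by subst e'; exact H g h l c e v w u
  exact LinearMap.congr_fun this (v ⊗ₜ t)

/-- The tensor product of morphisms. -/
noncomputable def tensorMap {V V' W W' : GVect k G} (f : V ⟶ V') (f' : W ⟶ W') :
    tensor V W ⟶ tensor V' W' :=
  ⟨fun _ => desc fun h l e => incl V' W' h l e ∘ₗ TensorProduct.map (f.app h) (f'.app l)⟩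

@[simp] theorem tensorMap_incl {V V' W W' : GVect k G} (f : V ⟶ V') (f' : W ⟶ W') (h l : G) {g : G}
    (e : h * l = g) (v : V.comp h) (w : W.comp l) :
    (tensorMap f f').app g (incl V W h l e (v ⊗ₜ w)) =
      incl V' W' h l e (f.app h v ⊗ₜ f'.app l w) := by
  simp [tensorMap]

/-- The map `(V ⊗ W) ⊗ U → V ⊗ (W ⊗ U)` sending `(v ⊗ w) ⊗ u` to `ψ(h, l, c) v ⊗ (w ⊗ u)` for
`v, w, u` homogeneous of degrees `h, l, c`. -/
noncomputable def assocHom (ψ : G → G → G → kˣ) (V W U : GVect k G) :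
    tensor (tensor V W) U ⟶ tensor V (tensor W U) :=
  ⟨fun g => desc fun a c e => TensorProduct.lift (desc fun h l e' => TensorProduct.curry
    ((ψ h l c : k) • (incl V (tensor W U) h (l * c) (by rw [← mul_assoc, e', e]) ∘ₗ
      (incl W U l c rfl).lTensor (V.comp h) ∘ₗ (TensorProduct.assoc k _ _ _).toLinearMap)))⟩

@[simp] theorem assocHom_incl (ψ : G → G → G → kˣ) (V W U : GVect k G) (h l c : G) {a g : G}
    (e' : h * l = a) (e : a * c = g) (v : V.comp h) (w : W.comp l) (u : U.comp c) :
    (assocHom ψ V W U).app g (incl (tensor V W) U a c e (incl V W h l e' (v ⊗ₜ w) ⊗ₜ u)) =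
      (ψ h l c : k) • incl V (tensor W U) h (l * c) (by rw [← mul_assoc, e', e])
        (v ⊗ₜ incl W U l c rfl (w ⊗ₜ u)) := by
  simp [assocHom]

/-- The inverse of `assocHom ψ`. -/
noncomputable def assocInv (ψ : G → G → G → kˣ) (V W U : GVect k G) :
    tensor V (tensor W U) ⟶ tensor (tensor V W) U :=
  ⟨fun g => desc fun h b e => TensorProduct.lift (LinearMap.flip (desc fun l c e' =>
    LinearMap.flip (TensorProduct.curry
      (((ψ h l c)⁻¹ : kˣ).val • (incl (tensor V W) U (h * l) c (by rw [mul_assoc, e', e]) ∘ₗ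
        (incl V W h l rfl).rTensor (U.comp c) ∘ₗ
          (TensorProduct.assoc k _ _ _).symm.toLinearMap)))))⟩

@[simp] theorem assocInv_incl (ψ : G → G → G → kˣ) (V W U : GVect k G) (h l c : G) {b g : G}
    (e' : l * c = b) (e : h * b = g) (v : V.comp h) (w : W.comp l) (u : U.comp c) :
    (assocInv ψ V W U).app g (incl V (tensor W U) h b e (v ⊗ₜ incl W U l c e' (w ⊗ₜ u))) =
      ((ψ h l c)⁻¹ : kˣ).val • incl (tensor V W) U (h * l) c (by rw [mul_assoc, e', e])
        (incl V W h l rfl (v ⊗ₜ w) ⊗ₜ u) := by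
  simp [assocInv]

/-- The isomorphism `α_ψ`. On simple objects it sends `(1_{g₁} ⊗ 1_{g₂}) ⊗ 1_{g₃}` to
`ψ(g₁, g₂, g₃) 1_{g₁} ⊗ (1_{g₂} ⊗ 1_{g₃})`. -/
noncomputable def assocIso (ψ : G → G → G → kˣ) (V W U : GVect k G) :
    tensor (tensor V W) U ≅ tensor V (tensor W U) where
  hom := assocHom ψ V W U
  inv := assocInv ψ V W U
  hom_inv_id := hom_ext_tensor_left fun g h l c e v w u => by simp [smul_smul]
  inv_hom_id := hom_ext_tensor_right fun g h l c e v w u => by simp [smul_smul]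

/-- The map `V ⊗ W → W ⊗ V` sending `v ⊗ w` to `Ω(l, h) w ⊗ v` for `v, w` homogeneous of degrees
`h, l`. -/
noncomputable def braidHom (Ω : G → G → kˣ) (V W : GVect k G) : tensor V W ⟶ tensor W V :=
  ⟨fun g => desc fun h l e => (Ω l h : k) •
    (incl W V l h (by rw [mul_comm, e]) ∘ₗ (TensorProduct.comm k _ _).toLinearMap)⟩

@[simp] theorem braidHom_incl (Ω : G → G → kˣ) (V W : GVect k G) (h l : G) {g : G} (e : h * l = g)
    (v : V.comp h) (w : W.comp l) :
    (braidHom Ω V W).app g (incl V W h l e (v ⊗ₜ w)) =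
      (Ω l h : k) • incl W V l h (by rw [mul_comm, e]) (w ⊗ₜ v) := by
  simp [braidHom]

/-- The isomorphism `γ_Ω`. On simple objects it sends `1_{g₁} ⊗ 1_{g₂}` to
`Ω(g₂, g₁) 1_{g₂} ⊗ 1_{g₁}`. -/
noncomputable def braidIso (Ω : G → G → kˣ) (V W : GVect k G) : tensor V W ≅ tensor W V where
  hom := braidHom Ω V W
  inv := braidHom (fun h l => (Ω l h)⁻¹) W V
  hom_inv_id := hom_ext_tensor fun g h l e v w => by simp [smul_smul]
  inv_hom_id := hom_ext_tensor fun g h l e v w => by simp [smul_smul]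

end Tensor

/-- The natural automorphism `θ_q` of the identity functor, given by multiplication with `q(g)` in
degree `g`. -/
noncomputable def twistIso (q : G → kˣ) : 𝟭 (GVect k G) ≅ 𝟭 (GVect k G) where
  hom :=
    { app := fun V => ⟨fun g => (q g : k) • LinearMap.id⟩
      naturality := fun V W f => by ext g v; simp }
  inv :=
    { app := fun V => ⟨fun g => ((q g)⁻¹ : kˣ).val • LinearMap.id⟩
      naturality := fun V W f => by ext g v; simp }
  hom_inv_id := by ext V g v; simp [smul_smul]
  inv_hom_id := by ext V g v; simp [smul_smul]

/-! ### Simple objects, tensor unit and unitors -/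

section Unit

open scoped Classical in
/-- The component `(k_g)_h = δ_{gh} k` of a simple object, as a subspace of `k`. -/
noncomputable def simpleComp (g h : G) : Submodule k k := if h = g then ⊤ else ⊥

theorem simpleComp_eq_zero {g h : G} (hne : h ≠ g) (x : simpleComp (k := k) g h) : x = 0 := by
  obtain ⟨x, hx⟩ := x
  exact Subtype.ext (by simpa [simpleComp, hne] using hx)

/-- The simple object `k_g`. -/
noncomputable def simple (g : G) : GVect k G where
  comp h := simpleComp (k := k) g h

/-- The basis vector `1_g` of the degree `g` component of `k_g`. -/
noncomputable def simpleOne (g : G) : (simple (k := k) g).comp g :=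
  (⟨1, by simp [simpleComp]⟩ : simpleComp (k := k) g g)

/-- The inclusion of `(k_g)_h` into `k`. -/
noncomputable def simpleCoeff (g h : G) : (simple (k := k) g).comp h →ₗ[k] k :=
  (simpleComp (k := k) g h).subtype

@[simp] theorem simpleCoeff_one (g : G) : simpleCoeff g g (simpleOne (k := k) g) = 1 := rfl

theorem simple_eq_smul {g : G} (x : (simple (k := k) g).comp g) :
    x = simpleCoeff g g x • simpleOne g :=
  Subtype.ext (mul_one _).symm

theorem simple_eq_zero {g h : G} (hne : h ≠ g) (x : (simple (k := k) g).comp h) : x = 0 :=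
  simpleComp_eq_zero hne x

open scoped Classical in
/-- The identity `V_a → V_b` if `a = b`, and zero otherwise. -/
noncomputable def shift (V : GVect k G) (a b : G) : V.comp a →ₗ[k] V.comp b :=
  if e : a = b then e ▸ LinearMap.id else 0

@[simp] theorem shift_self (V : GVect k G) (a : G) : V.shift a a = LinearMap.id := by
  simp [shift]

theorem shift_natural {V W : GVect k G} (f : V ⟶ W) (a b : G) (v : V.comp a) :
    W.shift a b (f.app a v) = f.app b (V.shift a b v) := by
  by_cases e : a = b
  · subst e; simp
  · simp [shift, e]

/-- The morphism `k_g ⟶ V` with `1_g ↦ v`, for `v` of degree `g`. -/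
noncomputable def fromSimple {V : GVect k G} {g : G} (v : V.comp g) : simple g ⟶ V :=
  ⟨fun h => LinearMap.smulRight (simpleCoeff g h) (V.shift g h v)⟩

@[simp] theorem fromSimple_one {V : GVect k G} {g : G} (v : V.comp g) :
    (fromSimple v).app g (simpleOne g) = v := by
  simp [fromSimple]

theorem hom_ext_simple {V W : GVect k G} {f f' : V ⟶ W}
    (H : ∀ (g : G) (i : simple g ⟶ V), i ≫ f = i ≫ f') : f = f' := by
  ext g v
  have := congrArg (fun t : simple g ⟶ W => t.app g (simpleOne g)) (H g (fromSimple v))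
  simpa using this

variable [CommGroup G] [Finite G]

/-- The map `k_1 ⊗ V → V`, `1 ⊗ v ↦ v`. -/
noncomputable def leftUnitHom (V : GVect k G) : tensor (simple 1) V ⟶ V :=
  ⟨fun g => desc fun h l _ =>
    TensorProduct.lift ((simpleCoeff 1 h).smulRight (V.shift l g))⟩

@[simp] theorem leftUnitHom_incl (V : GVect k G) (h l : G) {g : G} (e : h * l = g)
    (x : (simple (k := k) 1).comp h) (v : V.comp l) :
    (leftUnitHom V).app g (incl _ V h l e (x ⊗ₜ v)) = simpleCoeff 1 h x • V.shift l g v := by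
  simp [leftUnitHom]

/-- The left unitor `λ_V : k_1 ⊗ V ≅ V`. -/
noncomputable def leftUnit (V : GVect k G) : tensor (simple 1) V ≅ V where
  hom := leftUnitHom V
  inv := ⟨fun g => incl (simple 1) V 1 g (one_mul g) ∘ₗ TensorProduct.mk k _ _ (simpleOne 1)⟩
  hom_inv_id := hom_ext_tensor fun g h l e x v => by
    by_cases hh : h = 1
    · subst hh
      obtain rfl : l = g := by simpa using e
      rw [simple_eq_smul x]
      simp [TensorProduct.smul_tmul']
    · simp [simple_eq_zero hh x]
  inv_hom_id := by ext g v; simp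

/-- The map `V ⊗ k_1 → V`, `v ⊗ 1 ↦ v`. -/
noncomputable def rightUnitHom (V : GVect k G) : tensor V (simple 1) ⟶ V :=
  ⟨fun g => desc fun h l _ =>
    TensorProduct.lift ((simpleCoeff 1 l).smulRight (V.shift h g)).flip⟩

@[simp] theorem rightUnitHom_incl (V : GVect k G) (h l : G) {g : G} (e : h * l = g)
    (v : V.comp h) (x : (simple (k := k) 1).comp l) :
    (rightUnitHom V).app g (incl V _ h l e (v ⊗ₜ x)) = simpleCoeff 1 l x • V.shift h g v := by
  simp [rightUnitHom]

/-- The right unitor `ϱ_V : V ⊗ k_1 ≅ V`. -/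
noncomputable def rightUnit (V : GVect k G) : tensor V (simple 1) ≅ V where
  hom := rightUnitHom V
  inv := ⟨fun g => incl V (simple 1) g 1 (mul_one g) ∘ₗ
    (TensorProduct.mk k _ _).flip (simpleOne 1)⟩
  hom_inv_id := hom_ext_tensor fun g h l e v x => by
    by_cases hl : l = 1
    · subst hl
      obtain rfl : h = g := by simpa using e
      rw [simple_eq_smul x]
      simp [TensorProduct.smul_tmul']
    · simp [simple_eq_zero hl x]
  inv_hom_id := by ext g v; simp

end Unit

/-! ### The dualities `(-)^{g₀}` -/

section Duality

variable [CommGroup G]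

/-- The dual space `(V^{g₀})_g = (V_{g⁻¹ g₀})^*`. -/
noncomputable def dual (g₀ : G) (V : GVect k G) : GVect k G where
  comp g := Module.Dual k (V.comp (g⁻¹ * g₀))

/-- The duality functor `(-)^{g₀}`, acting on morphisms by transposition. -/
noncomputable def dualFunctor (g₀ : G) : (GVect k G)ᵒᵖ ⥤ GVect k G where
  obj V := dual g₀ V.unop
  map f := ⟨fun g => (f.unop.app (g⁻¹ * g₀)).dualMap⟩
  map_id _ := by
    ext g : 1
    exact LinearMap.dualMap_id
  map_comp _ _ := by
    ext g : 1
    exact (LinearMap.dualMap_comp_dualMap _ _).symm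

end Duality

variable [CommGroup G] [Finite G]

theorem tensorMap_id (V W : GVect k G) : tensorMap (𝟙 V) (𝟙 W) = 𝟙 (tensor V W) :=
  hom_ext_tensor fun g h l e v w => by simp

theorem tensorMap_comp {V₁ V₂ V₃ W₁ W₂ W₃ : GVect k G} (f₁ : V₁ ⟶ V₂) (f₂ : W₁ ⟶ W₂)
    (f₁' : V₂ ⟶ V₃) (f₂' : W₂ ⟶ W₃) :
    tensorMap f₁ f₂ ≫ tensorMap f₁' f₂' = tensorMap (f₁ ≫ f₁') (f₂ ≫ f₂') :=
  hom_ext_tensor fun g h l e v w => by simp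

theorem tensorMap_def {V₁ V₂ W₁ W₂ : GVect k G} (f : V₁ ⟶ V₂) (f' : W₁ ⟶ W₂) :
    tensorMap f f' = tensorMap f (𝟙 _) ≫ tensorMap (𝟙 _) f' := by
  rw [tensorMap_comp, Category.comp_id, Category.id_comp]

theorem leftUnit_naturality {V W : GVect k G} (f : V ⟶ W) :
    tensorMap (𝟙 _) f ≫ (leftUnit W).hom = (leftUnit V).hom ≫ f :=
  hom_ext_tensor fun g h l e x v => by simp [leftUnit, shift_natural]

theorem rightUnit_naturality {V W : GVect k G} (f : V ⟶ W) :
    tensorMap f (𝟙 _) ≫ (rightUnit W).hom = (rightUnit V).hom ≫ f :=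
  hom_ext_tensor fun g h l e x v => by simp [rightUnit, shift_natural]

/-- The tensor product, unit, unitors and inherited associator of graded vector spaces. -/
noncomputable instance : MonoidalCategoryStruct (GVect k G) where
  tensorObj := tensor
  tensorHom := tensorMap
  whiskerLeft V _ _ f := tensorMap (𝟙 V) f
  whiskerRight f V := tensorMap f (𝟙 V)
  tensorUnit := simple 1
  associator := assocIso 1
  leftUnitor := leftUnit
  rightUnitor := rightUnit

end GVect

/-! ### Weak ribbon monoidal structures -/

variable (k G : Type u) [Field k] [CommGroup G] [Finite G]

/-- Candidates `(α, γ, θ, g₀)` for an associator, a braiding and a twist on graded vector spaces,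
together with the degree `g₀` of a dualizing object. -/
structure RibbonData where
  assoc : ∀ X Y Z : GVect k G, (X ⊗ Y) ⊗ Z ≅ X ⊗ (Y ⊗ Z)
  braid : ∀ X Y : GVect k G, X ⊗ Y ≅ Y ⊗ X
  twist : 𝟭 (GVect k G) ≅ 𝟭 (GVect k G)
  pt : G

variable {k G}

/-- `(⊗, k, α, λ, ϱ, γ, θ)` is a weak ribbon monoidal structure with respect to the `⋆`-autonomous
duality `(-)^{g₀}`. (The duality is `⋆`-autonomous with dualizing object `k_{g₀}` whatever the
associator is: the natural isomorphisms `Hom(X ⊗ Y, k_{g₀}) ≅ Hom(X, Y^{g₀})` do not involve it.) -/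
structure RibbonData.IsWeakRibbon (D : RibbonData k G) : Prop where
  assoc_naturality : ∀ {X X' Y Y' Z Z' : GVect k G} (f : X ⟶ X') (g : Y ⟶ Y') (h : Z ⟶ Z'),
    ((f ⊗ₘ g) ⊗ₘ h) ≫ (D.assoc X' Y' Z').hom = (D.assoc X Y Z).hom ≫ (f ⊗ₘ (g ⊗ₘ h))
  pentagon : ∀ W X Y Z : GVect k G,
    (D.assoc W X Y).hom ▷ Z ≫ (D.assoc W (X ⊗ Y) Z).hom ≫ W ◁ (D.assoc X Y Z).hom =
      (D.assoc (W ⊗ X) Y Z).hom ≫ (D.assoc W X (Y ⊗ Z)).hom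
  triangle : ∀ X Y : GVect k G,
    (D.assoc X (𝟙_ _) Y).hom ≫ X ◁ (λ_ Y).hom = (ρ_ X).hom ▷ Y
  braid_naturality : ∀ {X X' Y Y' : GVect k G} (f : X ⟶ X') (g : Y ⟶ Y'),
    (f ⊗ₘ g) ≫ (D.braid X' Y').hom = (D.braid X Y).hom ≫ (g ⊗ₘ f)
  hexagon_forward : ∀ X Y Z : GVect k G,
    (D.assoc X Y Z).hom ≫ (D.braid X (Y ⊗ Z)).hom ≫ (D.assoc Y Z X).hom =
      (D.braid X Y).hom ▷ Z ≫ (D.assoc Y X Z).hom ≫ Y ◁ (D.braid X Z).hom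
  hexagon_reverse : ∀ X Y Z : GVect k G,
    (D.assoc X Y Z).inv ≫ (D.braid (X ⊗ Y) Z).hom ≫ (D.assoc Z X Y).inv =
      X ◁ (D.braid Y Z).hom ≫ (D.assoc X Z Y).inv ≫ (D.braid X Z).hom ▷ Y
  /-- `θ_{X ⊗ Y} = (θ_X ⊗ θ_Y) ∘ γ_{Y,X} ∘ γ_{X,Y}` -/
  twist_tensor : ∀ X Y : GVect k G,
    D.twist.hom.app (X ⊗ Y) =
      (D.braid X Y).hom ≫ (D.braid Y X).hom ≫ (D.twist.hom.app X ⊗ₘ D.twist.hom.app Y)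
  /-- `(θ_X)^{g₀} = θ_{X^{g₀}}` -/
  twist_dual : ∀ X : GVect k G,
    (GVect.dualFunctor D.pt).map (D.twist.hom.app X).op =
      D.twist.hom.app ((GVect.dualFunctor D.pt).obj (Opposite.op X))

variable (k G)

/-- The weak ribbon monoidal structures on the category of finite-dimensional `G`-graded vector
spaces. -/
def WRMS : Type (u + 1) := {D : RibbonData k G // D.IsWeakRibbon}

namespace WRMS

variable {k G}

/-- The category of graded vector spaces, to be equipped with the structure `S`. -/
@[nolint unusedArguments]
def Cat (_ : WRMS k G) : Type (u + 1) := GVect k G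

variable (S : WRMS k G)

instance : Category S.Cat := inferInstanceAs (Category (GVect k G))
instance : Preadditive S.Cat := inferInstanceAs (Preadditive (GVect k G))
instance : CategoryTheory.Linear k S.Cat := inferInstanceAs (CategoryTheory.Linear k (GVect k G))

/-- The simple object `k_g`. -/
noncomputable def simple (g : G) : S.Cat := GVect.simple (k := k) g

/-- The twist `θ_X`. -/
def twist (X : S.Cat) : X ⟶ X := S.1.twist.hom.app X

noncomputable instance : MonoidalCategory S.Cat where
  tensorObj X Y := MonoidalCategoryStruct.tensorObj (C := GVect k G) X Y
  tensorHom f g := MonoidalCategoryStruct.tensorHom (C := GVect k G) f g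
  whiskerLeft X _ _ f := MonoidalCategoryStruct.whiskerLeft (C := GVect k G) X f
  whiskerRight f X := MonoidalCategoryStruct.whiskerRight (C := GVect k G) f X
  tensorUnit := MonoidalCategoryStruct.tensorUnit (GVect k G)
  associator := S.1.assoc
  leftUnitor := MonoidalCategoryStruct.leftUnitor (C := GVect k G)
  rightUnitor := MonoidalCategoryStruct.rightUnitor (C := GVect k G)
  tensorHom_def := GVect.tensorMap_def
  id_tensorHom_id := GVect.tensorMap_id
  tensorHom_comp_tensorHom := GVect.tensorMap_comp
  whiskerLeft_id := GVect.tensorMap_id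
  id_whiskerRight := GVect.tensorMap_id
  associator_naturality := S.2.assoc_naturality
  leftUnitor_naturality := GVect.leftUnit_naturality
  rightUnitor_naturality := GVect.rightUnit_naturality
  pentagon := S.2.pentagon
  triangle := S.2.triangle

noncomputable instance : BraidedCategory S.Cat where
  braiding := S.1.braid
  braiding_naturality_right X _ _ f := S.2.braid_naturality (𝟙 X) f
  braiding_naturality_left f X := S.2.braid_naturality f (𝟙 X)
  hexagon_forward := S.2.hexagon_forward
  hexagon_reverse := S.2.hexagon_reverse

/-- Two weak ribbon monoidal structures `(α, γ, θ, g₀)` and `(α', γ', θ', g₀')` are equivalent if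
there is a `k`-linear braided (strong) monoidal equivalence `F` between the corresponding braided
monoidal categories with `F(θ_{k_g}) = θ'_{F(k_g)}` for all `g` which preserves the dualizing
objects, `F(k_{g₀}) ≅ k_{g₀'}`. -/
def Equivalent (S S' : WRMS k G) : Prop :=
  ∃ e : S.Cat ≌ S'.Cat, e.functor.Additive ∧ e.functor.Linear k ∧ Nonempty e.functor.Braided ∧
    (∀ g, e.functor.map (S.twist (S.simple g)) = S'.twist (e.functor.obj (S.simple g))) ∧
    Nonempty (e.functor.obj (S.simple S.1.pt) ≅ S'.simple S'.1.pt)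

variable {S} in
theorem twist_naturality {X Y : S.Cat} (f : X ⟶ Y) : f ≫ S.twist Y = S.twist X ≫ f :=
  S.1.twist.hom.naturality f

theorem map_twist {S S' : WRMS k G} (e : S.Cat ≌ S'.Cat)
    (h : ∀ g, e.functor.map (S.twist (S.simple g)) = S'.twist (e.functor.obj (S.simple g)))
    (X : S.Cat) : e.functor.map (S.twist X) = S'.twist (e.functor.obj X) := by
  obtain ⟨t, ht⟩ := e.functor.map_surjective (S'.twist (e.functor.obj X))
  rw [← ht]
  refine congrArg _ (GVect.hom_ext_simple (V := X) (W := X) fun g i => ?_)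
  refine e.functor.map_injective (X := S.simple g) ?_
  refine (congrArg e.functor.map (twist_naturality (X := S.simple g) i)).trans ?_
  refine (e.functor.map_comp _ _).trans ?_
  rw [h]
  refine (twist_naturality (S := S') _).symm.trans ?_
  rw [← ht]
  exact (e.functor.map_comp _ _).symm

end WRMS

/-- The inverse of a braided monoidal equivalence is braided monoidal. -/
theorem nonempty_braided_inverse {C D : Type*} [Category* C] [Category* D] [MonoidalCategory C]
    [MonoidalCategory D] [BraidedCategory C] [BraidedCategory D] (e : C ≌ D)
    [e.functor.Braided] : Nonempty e.inverse.Braided := by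
  let := e.inverseMonoidal
  have hμ (X Y : D) : (e.toAdjunction.homEquiv _ _).symm (Functor.LaxMonoidal.μ e.inverse X Y) =
      Functor.OplaxMonoidal.δ e.functor _ _ ≫
        (e.toAdjunction.counit.app X ⊗ₘ e.toAdjunction.counit.app Y) := by
    refine (Equiv.symm_apply_eq _).mpr ?_
    exact e.toAdjunction.rightAdjointLaxMonoidal_μ X Y
  refine ⟨{ braided := fun X Y => ?_ }⟩
  refine (e.toAdjunction.homEquiv _ _).symm.injective ?_
  rw [Adjunction.homEquiv_naturality_right_symm, Adjunction.homEquiv_naturality_left_symm, hμ, hμ]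
  simp

namespace WRMS

instance setoid : Setoid (WRMS k G) where
  r := Equivalent
  iseqv :=
    { refl := fun S =>
        ⟨CategoryTheory.Equivalence.refl, inferInstanceAs (𝟭 S.Cat).Additive,
          inferInstanceAs ((𝟭 S.Cat).Linear k), ⟨inferInstanceAs (𝟭 S.Cat).Braided⟩,
          fun _ => rfl, ⟨Iso.refl _⟩⟩
      symm := by
        rintro S S' ⟨e, ha, hl, ⟨hb⟩, ht, ⟨i⟩⟩
        refine ⟨e.symm, inferInstanceAs e.inverse.Additive, inferInstanceAs (e.inverse.Linear k),
          nonempty_braided_inverse e, fun g => ?_,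
          ⟨e.inverse.mapIso i.symm ≪≫ (e.unitIso.app _).symm⟩⟩
        refine e.functor.map_injective ?_
        refine Eq.trans ?_ (map_twist e ht _).symm
        refine (e.fun_inv_map _ _ _).trans ?_
        refine (congrArg (e.counit.app (S'.simple g) ≫ ·)
          (twist_naturality (S := S') (e.counitInv.app (S'.simple g))).symm).trans ?_
        exact (e.counitIso.app (S'.simple g)).hom_inv_id_assoc _
      trans := by
        rintro S S' S'' ⟨e, ha, hl, ⟨hb⟩, ht, ⟨i⟩⟩ ⟨e', ha', hl', ⟨hb'⟩, ht', ⟨i'⟩⟩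
        refine ⟨e.trans e', inferInstanceAs (e.functor ⋙ e'.functor).Additive,
          inferInstanceAs ((e.functor ⋙ e'.functor).Linear k),
          ⟨inferInstanceAs (e.functor ⋙ e'.functor).Braided⟩, fun g => ?_,
          ⟨e'.functor.mapIso i ≪≫ i'⟩⟩
        exact (congrArg e'.functor.map (ht g)).trans (map_twist e' ht' _) }

end WRMS

variable {k G}

/-- The candidate `(α_ψ, γ_Ω, θ_t, g₀)`. -/
noncomputable def RibbonData.of (c : AbelianCocycle k G) (t : G → kˣ) (g₀ : G) :
    RibbonData k G where
  assoc := GVect.assocIso c.ψ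
  braid := GVect.braidIso c.Ω
  twist := GVect.twistIso t
  pt := g₀

end GradedVectorSpaces

/-! ## Abelian 3-cocycles on groups of odd order -/

/-! Everything is reduced to functions on `G`. Every graded space is built from the lines `k_g`, so
naturality forces an associator, a braiding and a twist to act on homogeneous vectors by scalars
`ψ`, `Ω`, `t`. The braided monoidal axioms then say that `(ψ, Ω)` is a normalized abelian 3-cocycle.
Compatibility of the twist with the braiding says that `t` has the polar form `Ω(g, h) Ω(h, g)`, and
compatibility with the duality says that `t(g⁻¹ p) = t(g)`, where `p` is the degree of the dualizing
object.

The cohomological input is that in odd order an abelian 3-cocycle is determined up to coboundary by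
its diagonal. By `IsAbelianCocycle.exists_coboundary` the associator is a coboundary `dκ`.
Correcting `Ω` by `κ` makes it bimultiplicative without changing its diagonal, and two
bimultiplicative braidings with the same diagonal differ by an alternating form, which square roots
exhibit as the antisymmetrization of a bimultiplicative cochain (`IsAbelianCocycle.exists_gauge`).
Conversely `Ω(g, h) = β_q(√g, h)` with trivial `ψ` has diagonal `q`.

On the side of forms, the triple `(q, η, g₀)` is recovered from `t = q η` and `p = g₀⁻²`: `q` is
even, characters with trivial square are trivial, and square roots are unique
(`WRQF.q_eq_of_total_eq`, `WRQF.exists_of_total`). This gives surjectivity.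

An automorphism `f` relating two triples gives an equivalence: regrade along `f`, with a gauge
cochain as tensorator (`WRMS.equivalent_of_gauge`). Conversely an equivalence sends simple objects
to simple objects and so induces an automorphism of `G` which carries the twist scalars and `p`
along (`WRMS.Equivalent.exists_mulEquiv`). -/

section AbelianCocycles

/-- Normalized abelian 3-cocycles `(ψ, Ω)` with values in an additive group. -/
structure IsAbelianCocycle {G A : Type*} [CommGroup G] [AddCommGroup A] (ψ : G → G → G → A)
    (Ω : G → G → A) : Prop where
  one_left : ∀ g h, ψ 1 g h = 0
  one_mid : ∀ g h, ψ g 1 h = 0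
  one_right : ∀ g h, ψ g h 1 = 0
  pentagon : ∀ g₁ g₂ g₃ g₄, ψ g₂ g₃ g₄ - ψ (g₁ * g₂) g₃ g₄ + ψ g₁ (g₂ * g₃) g₄
    - ψ g₁ g₂ (g₃ * g₄) + ψ g₁ g₂ g₃ = 0
  hexagon_left : ∀ g₁ g₂ g₃,
    -ψ g₂ g₃ g₁ + Ω g₁ (g₂ * g₃) - ψ g₁ g₂ g₃ = Ω g₁ g₃ - ψ g₂ g₁ g₃ + Ω g₁ g₂
  hexagon_right : ∀ g₁ g₂ g₃,
    ψ g₃ g₁ g₂ + Ω (g₁ * g₂) g₃ + ψ g₁ g₂ g₃ = Ω g₁ g₃ + ψ g₁ g₃ g₂ + Ω g₂ g₃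

/-- The coboundary of a 2-cochain. -/
def coboundary {G A : Type*} [CommGroup G] [AddCommGroup A] (κ : G → G → A) (g h l : G) : A :=
  κ h l - κ (g * h) l + κ g (h * l) - κ g h

variable {G A : Type*} [CommGroup G] [AddCommGroup A] {ψ : G → G → G → A} {Ω : G → G → A}

namespace IsAbelianCocycle

theorem comap {H : Type*} [CommGroup H] (c : IsAbelianCocycle ψ Ω) (φ : H →* G) :
    IsAbelianCocycle (fun g h l => ψ (φ g) (φ h) (φ l)) (fun g h => Ω (φ g) (φ h)) where
  one_left g h := by simp [c.one_left]
  one_mid g h := by simp [c.one_mid]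
  one_right g h := by simp [c.one_right]
  pentagon _ _ _ _ := by simpa using c.pentagon _ _ _ _
  hexagon_left _ _ _ := by simpa using c.hexagon_left _ _ _
  hexagon_right _ _ _ := by simpa using c.hexagon_right _ _ _

/-- The interchange cochain comparing `(x y) (z w)` with `(x z) (y w)`. -/
def interchange (ψ : G → G → G → A) (Ω : G → G → A) (x y z w : G) : A :=
  ψ x y (z * w) - ψ y z w + Ω z y + ψ z y w - ψ x z (y * w)

/-- The braiding makes the multiplication `G × G → G` a monoidal functor with the interchange as
tensorator. This is its associativity coherence, a combination of two hexagons and eleven pentagons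
once products are sorted by commutativity. -/
theorem interchange_coboundary (c : IsAbelianCocycle ψ Ω) (x y z w u v : G) :
    interchange ψ Ω z w u v - interchange ψ Ω (x * z) (y * w) u v
      + interchange ψ Ω x y (z * u) (w * v) - interchange ψ Ω x y z w =
    ψ x z u + ψ y w v - ψ (x * y) (z * w) (u * v) := by
  have h₁ := c.hexagon_left u y w
  have h₂ := c.hexagon_right z u y
  have p₁ := c.pentagon x y (w * z) (u * v)
  have p₂ := c.pentagon y z w (u * v)
  have p₃ := c.pentagon y z u (v * w)
  have p₄ := c.pentagon x z (w * y) (u * v)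
  have p₅ := c.pentagon x z u (v * w * y)
  have p₆ := c.pentagon z y w (u * v)
  have p₇ := c.pentagon y w u v
  have p₈ := c.pentagon u y w v
  have p₉ := c.pentagon y u w v
  have q₁ := c.pentagon z u y (v * w)
  have q₂ := c.pentagon z y u (v * w)
  simp only [interchange, mul_comm, mul_left_comm] at *
  grind

/-- Pullbacks of an abelian 3-cocycle along endomorphisms with trivial associator are closed under
multiplication of endomorphisms. -/
theorem exists_coboundary_mul (c : IsAbelianCocycle ψ Ω) {H : Type*} [CommGroup H]
    {φ φ' : H →* G}
    (h : ∃ κ : H → H → A, ∀ x y z, ψ (φ x) (φ y) (φ z) = coboundary κ x y z)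
    (h' : ∃ κ : H → H → A, ∀ x y z, ψ (φ' x) (φ' y) (φ' z) = coboundary κ x y z) :
    ∃ κ : H → H → A,
      ∀ x y z, ψ ((φ * φ') x) ((φ * φ') y) ((φ * φ') z) = coboundary κ x y z := by
  obtain ⟨κ, hκ⟩ := h
  obtain ⟨κ', hκ'⟩ := h'
  -- The interchange, pulled back along `(φ, φ')`, has as coboundary the sum of the two pullbacks of
  -- `ψ` minus the pullback along `φ * φ'`.
  refine ⟨fun x y => κ x y + κ' x y - interchange ψ Ω (φ x) (φ' x) (φ y) (φ' y), fun x y z => ?_⟩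
  have := c.interchange_coboundary (φ x) (φ' x) (φ y) (φ' y) (φ z) (φ' z)
  rw [hκ, hκ'] at this
  simp only [coboundary, map_mul, MonoidHom.mul_apply] at this ⊢
  grind

end IsAbelianCocycle

/-- On a finite cyclic group, a function with trivial sum has a primitive. -/
theorem exists_primitive_of_sum_eq_zero [Fintype G] {x : G} (hx : ∀ y, y ∈ Subgroup.zpowers x)
    (f : G → A) (hf : ∑ l, f l = 0) : ∃ F : G → A, F 1 = 0 ∧ ∀ l, F (l * x) = F l + f l := by
  classical
  have hn : orderOf x = Fintype.card G := by
    rw [← Nat.card_eq_fintype_card]; exact orderOf_eq_card_of_forall_mem_zpowers hx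
  have hm : ∀ l, ∃ m : ℕ, x ^ m = l := fun l =>
    (mem_powers_iff_mem_zpowers (x := x) (y := l)).mpr (hx l)
  choose m hm using hm
  -- The primitive is a partial sum along the powers of `x`. Vanishing of the total sum makes it
  -- periodic, hence independent of the chosen exponent.
  let P : ℕ → A := fun j => ∑ i ∈ Finset.range j, f (x ^ i)
  have hsum : P (orderOf x) = 0 := by
    rw [← hf]
    refine Finset.sum_bij (fun i _ => x ^ i) (fun _ _ => Finset.mem_univ _) ?_ ?_ (fun _ _ => rfl)
    · intro i hi j hj h
      exact pow_injOn_Iio_orderOf (by simpa using hi) (by simpa using hj) h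
    · intro l _
      exact ⟨m l % orderOf x, by simpa using Nat.mod_lt _ (orderOf_pos x),
        by rw [pow_mod_orderOf, hm]⟩
  have hper : Function.Periodic P (orderOf x) := fun j => by
    have : P (j + orderOf x) = P (orderOf x) + P j := by
      simp only [P]
      rw [add_comm j, Finset.sum_range_add]
      simp [pow_add]
    rw [this, hsum, zero_add]
  have hP : ∀ i j, x ^ i = x ^ j → P i = P j := fun i j h => by
    rw [← hper.map_mod_nat i, ← hper.map_mod_nat j]
    exact congrArg P (pow_inj_mod.mp h)
  refine ⟨fun l => P (m l), ?_, fun l => ?_⟩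
  · exact (hP (m 1) 0 (by simp [hm])).trans (by simp [P])
  · refine (hP (m (l * x)) (m l + 1) (by rw [pow_succ, hm, hm])).trans ?_
    simp only [P, Finset.sum_range_succ, hm]

theorem sum_mul_right_eq [Fintype G] (f : G → A) (g : G) : ∑ l, f (l * g) = ∑ l, f l :=
  Fintype.sum_equiv (Equiv.mulRight g) _ _ fun _ => rfl

theorem sum_mul_left_eq [Fintype G] (f : G → A) (g : G) : ∑ l, f (g * l) = ∑ l, f l :=
  Fintype.sum_equiv (Equiv.mulLeft g) _ _ fun _ => rfl

/-- The obstruction to writing `ψ` as a coboundary is the homomorphism `C(g) = ∑ ψ(g, l, x)`.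
Summing the two hexagons gives `C(x) = -n Ω(x, x)` and `C(x) = n Ω(x, x)` with `n = |G|`, so `2 C(x)
= 0`. Also `n C(x) = C(x ^ n) = 0`, and `n` is odd, so `C` vanishes. -/
theorem IsAbelianCocycle.exists_coboundary_of_cyclic (c : IsAbelianCocycle ψ Ω) [Fintype G]
    (hodd : Odd (Fintype.card G)) {x : G} (hx : ∀ y, y ∈ Subgroup.zpowers x) :
    ∃ κ : G → G → A, ∀ g h l, ψ g h l = coboundary κ g h l := by
  classical
  let C : G → A := fun g => ∑ l, ψ g l x
  have hC : ∀ g h, C (g * h) = C g + C h := fun g h => by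
    have := Finset.sum_congr rfl fun l (_ : l ∈ Finset.univ) => c.pentagon g h l x
    simp only [Finset.sum_add_distrib, Finset.sum_sub_distrib, Finset.sum_const_zero,
      sum_mul_left_eq (fun l => ψ g l x) h, sum_mul_right_eq (fun l => ψ g h l) x] at this
    simp only [C]
    grind
  have h₁ : C x = - (Fintype.card G • Ω x x) := by
    have := Finset.sum_congr rfl fun l (_ : l ∈ Finset.univ) => c.hexagon_left x l x
    simp only [Finset.sum_add_distrib, Finset.sum_sub_distrib, Finset.sum_neg_distrib,
      Finset.sum_const, Finset.card_univ, sum_mul_right_eq (fun l => Ω x l) x] at this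
    simp only [C]
    grind
  have h₂ : C x = Fintype.card G • Ω x x := by
    have := Finset.sum_congr rfl fun l (_ : l ∈ Finset.univ) => c.hexagon_right l x x
    simp only [Finset.sum_add_distrib, Finset.sum_const, Finset.card_univ,
      sum_mul_right_eq (fun l => Ω l x) x] at this
    simp only [C]
    grind
  have hC1 : C 1 = 0 := by simp [C, c.one_left]
  let Ch : G →* Multiplicative A :=
    { toFun := fun g => Multiplicative.ofAdd (C g)
      map_one' := by rw [hC1]; rfl
      map_mul' := fun g h => by rw [hC]; rfl }
  have hCx : Ch x = 1 := by
    have h2 : Ch x ^ 2 = 1 := by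
      refine Multiplicative.toAdd.injective ?_
      change 2 • C x = 0
      rw [two_nsmul]
      nth_rw 1 [h₁]
      rw [h₂]; abel
    have hn : Ch x ^ Fintype.card G = 1 := by rw [← map_pow, pow_card_eq_one, map_one]
    have := Nat.dvd_gcd (orderOf_dvd_of_pow_eq_one h2) (orderOf_dvd_of_pow_eq_one hn)
    rw [Nat.Coprime.gcd_eq_one (Nat.coprime_two_left.mpr hodd)] at this
    exact orderOf_eq_one_iff.mp (Nat.dvd_one.mp this)
  have hC0 : ∀ g, C g = 0 := fun g => by
    obtain ⟨m, rfl⟩ := hx g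
    have : Ch (x ^ m) = 1 := by rw [map_zpow, hCx, one_zpow]
    exact this
  -- This choice makes `ψ = dκ` when the last argument is the generator `x`, since `κ(g, x) - κ(g,
  -- 1) = ψ(g, 1, x) = 0`. The pentagon extends it to powers of `x` by induction.
  choose κ hκ1 hκ using fun g => exists_primitive_of_sum_eq_zero hx (fun l => ψ g l x) (hC0 g)
  refine ⟨κ, fun g h l => ?_⟩
  obtain ⟨m, rfl⟩ := (mem_powers_iff_mem_zpowers (x := x) (y := l)).mpr (hx l)
  simp only
  induction m with
  | zero => simp [coboundary, c.one_right, hκ1]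
  | succ m ih =>
    have p := c.pentagon g h (x ^ m) x
    have e₁ := hκ h (x ^ m)
    have e₂ := hκ (g * h) (x ^ m)
    have e₃ := hκ g (h * x ^ m)
    simp only [coboundary, pow_succ, mul_assoc] at *
    grind

theorem MonoidHom.id_eq_prod_single {ι : Type*} [Fintype ι] [DecidableEq ι] (M : ι → Type*)
    [∀ i, CommGroup (M i)] :
    MonoidHom.id (∀ i, M i) = ∏ i, (MonoidHom.mulSingle M i).comp (Pi.evalMonoidHom M i) := by
  ext x i
  simp [Finset.prod_apply]

/-- On a finite abelian group of odd order, the associator of an abelian 3-cocycle is a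
coboundary. -/
theorem IsAbelianCocycle.exists_coboundary [Finite G] (c : IsAbelianCocycle ψ Ω)
    (hodd : Odd (Nat.card G)) :
    ∃ κ : G → G → A, (∀ g, κ 1 g = 0) ∧ (∀ g, κ g 1 = 0) ∧
      ∀ g h l, ψ g h l = coboundary κ g h l := by
  classical
  obtain ⟨ι, _, n, hn, ⟨e⟩⟩ := CommGroup.equiv_prod_multiplicative_zmod_of_finite G
  have : ∀ i, NeZero (n i) := fun i => ⟨by have := hn i; omega⟩
  have key : ∃ κ : G → G → A, ∀ x y z, ψ ((MonoidHom.id G) x) ((MonoidHom.id G) y)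
      ((MonoidHom.id G) z) = coboundary κ x y z := by
    -- The identity is a product of endomorphisms factoring through cyclic groups of odd order. The
    -- cyclic case handles each factor, and `exists_coboundary_mul` multiplies them together.
    have hid : MonoidHom.id G = ∏ i, (e.symm.toMonoidHom.comp
        ((MonoidHom.mulSingle (fun i => Multiplicative (ZMod (n i))) i))).comp
          ((Pi.evalMonoidHom _ i).comp e.toMonoidHom) := by
      ext x
      have := congrArg e.symm (DFunLike.congr_fun (MonoidHom.id_eq_prod_single
        (fun i => Multiplicative (ZMod (n i)))) (e x))
      simpa [MonoidHom.finsetProd_apply] using this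
    rw [hid]
    refine Finset.prod_induction _ (fun φ : G →* G => ∃ κ : G → G → A, ∀ x y z,
      ψ (φ x) (φ y) (φ z) = coboundary κ x y z) (fun _ _ => c.exists_coboundary_mul)
      ⟨fun _ _ => 0, fun x y z => by simp [coboundary, c.one_left]⟩ fun i _ => ?_
    have hi : Odd (Fintype.card (Multiplicative (ZMod (n i)))) := by
      refine Odd.of_dvd_nat hodd ?_
      rw [Nat.card_congr e.toEquiv, Nat.card_pi]
      simpa using Finset.dvd_prod_of_mem (fun i => Nat.card (Multiplicative (ZMod (n i))))
        (Finset.mem_univ i)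
    obtain ⟨κ, hκ⟩ := (c.comap (e.symm.toMonoidHom.comp (MonoidHom.mulSingle
      (fun i => Multiplicative (ZMod (n i))) i))).exists_coboundary_of_cyclic hi
      (x := Multiplicative.ofAdd 1) (fun y => ⟨(Multiplicative.toAdd y).val, by
        refine Multiplicative.toAdd.injective ?_
        simp⟩)
    refine ⟨fun x y => κ (e x i) (e y i), fun x y z => ?_⟩
    simpa [coboundary] using hκ (e x i) (e y i) (e z i)
  obtain ⟨κ, hκ⟩ := key
  have h₁ : ∀ g, κ 1 g = κ 1 1 := fun g => by
    have := hκ 1 1 g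
    simp only [coboundary, MonoidHom.id_apply, c.one_left, one_mul] at this
    grind
  have h₂ : ∀ g, κ g 1 = κ 1 1 := fun g => by
    have := hκ g 1 1
    simp only [coboundary, MonoidHom.id_apply, c.one_right, mul_one] at this
    grind
  -- A constant 2-cochain has zero coboundary, so subtracting `κ 1 1` normalizes `κ` at no cost.
  refine ⟨fun g h => κ g h - κ 1 1, fun g => by simp [h₁], fun g => by simp [h₂], fun g h l => ?_⟩
  refine (hκ g h l).trans ?_
  simp only [coboundary]
  abel

/-- The square root homomorphism of a finite abelian group of odd order. -/
theorem exists_sqrt_hom (hG : ∀ g : G, ∃ h : G, h * h = g) [Finite G] :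
    ∃ s : G →* G, ∀ g, s g * s g = g := by
  have hbij : Function.Bijective (powMonoidHom 2 : G →* G) := by
    refine Finite.surjective_iff_bijective.mp fun g => ?_
    obtain ⟨h, rfl⟩ := hG g
    exact ⟨h, by simp [pow_two]⟩
  let e := MulEquiv.ofBijective (powMonoidHom 2 : G →* G) hbij
  refine ⟨e.symm.toMonoidHom, fun g => ?_⟩
  rw [← pow_two]
  exact e.apply_symm_apply g

/-- Squaring is surjective, hence injective on a finite group, which excludes elements of order two;
Cauchy's theorem concludes. -/
theorem odd_card_of_sqrt (hG : ∀ g : G, ∃ h : G, h * h = g) [Finite G] : Odd (Nat.card G) := by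
  by_contra hodd
  rw [Nat.not_odd_iff_even, even_iff_two_dvd] at hodd
  obtain ⟨x, hx⟩ := exists_prime_orderOf_dvd_card' 2 hodd
  have hbij : Function.Injective fun g : G => g * g :=
    Finite.injective_iff_surjective.mpr hG
  have : x = 1 := hbij (by simpa [← pow_two, hx] using pow_orderOf_eq_one x)
  simp [this] at hx

end AbelianCocycles

/-! ### Bimultiplicative braidings, and uniqueness of the cocycle with given diagonal -/

section AbelianCocycles

variable {G A : Type*} [CommGroup G] [AddCommGroup A] {ψ ψ' : G → G → G → A} {Ω Ω' : G → G → A}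

namespace IsAbelianCocycle

/-- If the associator is the coboundary of `κ`, the braiding becomes bimultiplicative after
changing it by `κ`. -/
theorem bihom_of_coboundary (c : IsAbelianCocycle ψ Ω) {κ : G → G → A}
    (hκ : ∀ g h l, ψ g h l = coboundary κ g h l) {B : G → G → A}
    (hB : ∀ g h, B g h = Ω g h - κ g h + κ h g) :
    (∀ a b d, B (a * b) d = B a d + B b d) ∧ ∀ a b d, B a (b * d) = B a b + B a d := by
  constructor <;> intro x y z
  · have := c.hexagon_right x y z
    simp only [hB, hκ, coboundary, mul_comm] at this ⊢
    grind
  · have := c.hexagon_left x y z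
    simp only [hB, hκ, coboundary, mul_comm] at this ⊢
    grind

/-- An additive function in each variable satisfies the usual rule for inverses. -/
theorem _root_.bihom_inv_inv {B : G → G → A} (hl : ∀ a b d, B (a * b) d = B a d + B b d)
    (hr : ∀ a b d, B a (b * d) = B a b + B a d) (g h : G) : B g⁻¹ h⁻¹ = B g h := by
  have h₁ := hl 1 1 h
  have h₂ := hl g g⁻¹ h
  have h₃ := hr g⁻¹ 1 1
  have h₄ := hr g⁻¹ h h⁻¹
  simp only [mul_one, mul_inv_cancel] at *
  grind

section Odd

variable [Finite G] (hG : ∀ g : G, ∃ h : G, h * h = g)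

include hG

theorem exists_bihom (c : IsAbelianCocycle ψ Ω) :
    ∃ κ B : G → G → A, (∀ g, κ 1 g = 0) ∧ (∀ g, κ g 1 = 0) ∧
      (∀ g h l, ψ g h l = coboundary κ g h l) ∧ (∀ g h, B g h = Ω g h - κ g h + κ h g) ∧
      (∀ a b d, B (a * b) d = B a d + B b d) ∧ ∀ a b d, B a (b * d) = B a b + B a d := by
  obtain ⟨κ, h₁, h₂, hκ⟩ := c.exists_coboundary (odd_card_of_sqrt hG)
  exact ⟨κ, _, h₁, h₂, hκ, fun _ _ => rfl, c.bihom_of_coboundary hκ fun _ _ => rfl⟩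

/-- The bimultiplicative `B` has the same diagonal and the same symmetrization as `Ω`, because the
correction by `κ` is antisymmetric. This law and the next two are therefore read off from `B`. -/
theorem diag_mul (c : IsAbelianCocycle ψ Ω) (g h : G) :
    Ω (g * h) (g * h) - Ω g g - Ω h h = Ω g h + Ω h g := by
  obtain ⟨κ, B, -, -, -, hB, hl, hr⟩ := c.exists_bihom hG
  have h₁ := hl g h (g * h)
  have h₂ := hr g g h
  have h₃ := hr h g h
  simp only [hB] at *
  grind

theorem diag_inv (c : IsAbelianCocycle ψ Ω) (g : G) : Ω g g = Ω g⁻¹ g⁻¹ := by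
  obtain ⟨κ, B, -, -, -, hB, hl, hr⟩ := c.exists_bihom hG
  have := bihom_inv_inv hl hr g g
  simp only [hB] at this
  grind

theorem symm_bihom_left (c : IsAbelianCocycle ψ Ω) (x y z : G) :
    Ω (x * y) z + Ω z (x * y) = Ω x z + Ω z x + (Ω y z + Ω z y) := by
  obtain ⟨κ, B, -, -, -, hB, hl, hr⟩ := c.exists_bihom hG
  have h₁ := hl x y z
  have h₂ := hr z x y
  simp only [hB] at *
  grind

/-- On a finite abelian group of odd order, abelian 3-cocycles with the same diagonal are
cohomologous. -/
theorem exists_gauge (c : IsAbelianCocycle ψ Ω) (c' : IsAbelianCocycle ψ' Ω')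
    (hd : ∀ g, Ω g g = Ω' g g) :
    ∃ κ : G → G → A, (∀ g, κ 1 g = 0) ∧ (∀ g, κ g 1 = 0) ∧
      (∀ g h l, ψ g h l - ψ' g h l = coboundary κ g h l) ∧
      ∀ g h, Ω g h - Ω' g h = κ g h - κ h g := by
  obtain ⟨κ, B, h₁, h₂, hκ, hB, hl, hr⟩ := c.exists_bihom hG
  obtain ⟨κ', B', h₁', h₂', hκ', hB', hl', hr'⟩ := c'.exists_bihom hG
  obtain ⟨s, hs⟩ := exists_sqrt_hom hG
  obtain ⟨E, hE⟩ : ∃ E : G → G → A, ∀ g h, E g h = B g h - B' g h := ⟨_, fun _ _ => rfl⟩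
  have El : ∀ a b d, E (a * b) d = E a d + E b d := fun a b d => by
    have := hl a b d
    have := hl' a b d
    grind
  have Er : ∀ a b d, E a (b * d) = E a b + E a d := fun a b d => by
    have := hr a b d
    have := hr' a b d
    grind
  have Ed : ∀ g, E g g = 0 := fun g => by
    have := hd g
    grind
  -- An alternating form is antisymmetric: expand `E (g * h) (g * h) = 0`.
  have Es : ∀ g h, E g h = - E h g := fun g h => by
    have := Ed (g * h)
    rw [El, Er, Er, Ed, Ed] at this
    grind
  have E1 : ∀ g, E 1 g = 0 := fun g => by simpa using El 1 1 g
  have E1' : ∀ g, E g 1 = 0 := fun g => by simpa using Er g 1 1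
  -- `E (s g) h` is half of `E g h`. Being bimultiplicative, it has zero coboundary and leaves the
  -- associators alone; its antisymmetrization is `E`, which absorbs the difference of the
  -- braidings.
  refine ⟨fun g h => κ g h - κ' g h + E (s g) h, fun g => ?_, fun g => ?_, fun g h l => ?_,
    fun g h => ?_⟩
  · simp [h₁, h₁', E1]
  · simp [h₂, h₂', E1']
  · rw [hκ, hκ']
    simp only [coboundary, map_mul, El, Er]
    abel
  · have e₁ : E (s g) h = E (s g) (s h) + E (s g) (s h) := by rw [← Er, hs]
    have e₂ : E (s h) g = E (s h) (s g) + E (s h) (s g) := by rw [← Er, hs]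
    have e₃ : E g h = E (s g) h + E (s g) h := by rw [← El, hs]
    have e₄ := Es (s g) (s h)
    have e₅ := hE g h
    have := hB g h
    have := hB' g h
    grind

end Odd

end IsAbelianCocycle

end AbelianCocycles

/-! ### Abelian 3-cocycles versus quadratic forms -/

section QuadraticForms

variable {k G : Type u} [Field k] [CommGroup G]

theorem AbelianCocycle.isAbelianCocycle (c : AbelianCocycle k G) :
    IsAbelianCocycle (A := Additive kˣ) (fun g h l => .ofMul (c.ψ g h l))
      (fun g h => .ofMul (c.Ω g h)) where
  one_left g h := congrArg Additive.ofMul (c.ψ_one_left g h)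
  one_mid g h := congrArg Additive.ofMul (c.ψ_one_mid g h)
  one_right g h := congrArg Additive.ofMul (c.ψ_one_right g h)
  pentagon g₁ g₂ g₃ g₄ := by
    simpa [sub_eq_add_neg] using congrArg Additive.ofMul (c.coboundary_eq_one g₁ g₂ g₃ g₄)
  hexagon_left g₁ g₂ g₃ := by
    simpa [sub_eq_add_neg] using congrArg Additive.ofMul (c.cocycle_left g₁ g₂ g₃)
  hexagon_right g₁ g₂ g₃ := by
    simpa [sub_eq_add_neg] using congrArg Additive.ofMul (c.cocycle_right g₁ g₂ g₃)

namespace AbelianCocycle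

section Odd

variable [Finite G] (hG : ∀ g : G, ∃ h : G, h * h = g)

include hG

theorem assocForm_emImage (c : AbelianCocycle k G) (g h : G) :
    assocForm c.emImage g h = c.Ω g h * c.Ω h g := by
  have := c.isAbelianCocycle.diag_mul hG g h
  simp only [sub_eq_add_neg] at this
  exact congrArg Additive.toMul this

/-- The EM-image of an abelian 3-cocycle as a quadratic form. -/
def quadForm (c : AbelianCocycle k G) : QuadForm k G where
  toFun := c.emImage
  symm g := congrArg Additive.toMul (c.isAbelianCocycle.diag_inv hG g)
  bihom_left a b d := by
    simp only [c.assocForm_emImage hG]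
    exact congrArg Additive.toMul (c.isAbelianCocycle.symm_bihom_left hG a b d)
  bihom_right a b d := by
    simp only [c.assocForm_emImage hG]
    have := congrArg Additive.toMul (c.isAbelianCocycle.symm_bihom_left hG b d a)
    simp only [toMul_add, toMul_ofMul] at this
    rw [mul_comm, this]
    ac_rfl

/-- Cocycles whose EM-images are related by an automorphism are cohomologous along it. -/
theorem exists_gauge (c c' : AbelianCocycle k G) (f : G ≃* G)
    (hd : ∀ g, c.emImage g = c'.emImage (f g)) :
    ∃ κ : G → G → kˣ, (∀ g, κ 1 g = 1) ∧ (∀ g, κ g 1 = 1) ∧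
      (∀ g h l, κ g h * κ (g * h) l * c.ψ (f.symm g) (f.symm h) (f.symm l) =
        c'.ψ g h l * κ h l * κ g (h * l)) ∧
      ∀ g h, κ g h * c.Ω (f.symm h) (f.symm g) = c'.Ω h g * κ h g := by
  -- The pullback of `c` along `f⁻¹` has the same diagonal as `c'`. The conclusions are then written
  -- in the form needed for the tensorator of a regrading functor.
  obtain ⟨κ, h₁, h₂, h₃, h₄⟩ := (c.isAbelianCocycle.comap f.symm.toMonoidHom).exists_gauge hG
    c'.isAbelianCocycle (fun g => congrArg Additive.ofMul
      ((hd (f.symm g)).trans (congrArg _ (f.apply_symm_apply g))))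
  refine ⟨fun g h => (κ g h).toMul, h₁, h₂, fun g h l => ?_, fun g h => ?_⟩
  · refine Additive.ofMul.injective ?_
    have := h₃ g h l
    simp only [coboundary, MulEquiv.toMonoidHom_eq_coe, MonoidHom.coe_coe] at this
    simp only [ofMul_mul, ofMul_toMul]
    grind
  · refine Additive.ofMul.injective ?_
    have := h₄ h g
    simp only [MulEquiv.toMonoidHom_eq_coe, MonoidHom.coe_coe] at this
    simp only [ofMul_mul, ofMul_toMul]
    grind

end Odd

end AbelianCocycle

namespace QuadForm

variable (q : QuadForm k G)

/-- The bicharacter `β_q`. -/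
def polar : G →* G →* kˣ :=
  MonoidHom.mk' (fun g => MonoidHom.mk' (assocForm q.toFun g) (q.bihom_right g))
    fun a b => MonoidHom.ext (q.bihom_left a b)

theorem polar_apply (g h : G) : q.polar g h = assocForm q.toFun g h := rfl

theorem map_mul (g h : G) : q.toFun (g * h) = q.toFun g * q.toFun h * q.polar g h := by
  rw [polar_apply, assocForm]
  simp [mul_comm, mul_left_comm]

theorem map_one : q.toFun 1 = 1 := by
  have := q.map_mul 1 1
  simpa using this

theorem polar_self (g : G) : q.polar g g = q.toFun g * q.toFun g := by
  have := q.map_mul g g⁻¹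
  rw [mul_inv_cancel, q.map_one, ← q.symm, _root_.map_inv] at this
  exact (mul_inv_eq_one.mp this.symm).symm

/-- Half of the polar form is a bicharacter, hence a braiding for the trivial associator. With `s`
the square root, its diagonal is `β_q(s g, s g)² = q(s g)⁴ = q(g)`. -/
theorem exists_cocycle [Finite G] (hG : ∀ g : G, ∃ h : G, h * h = g) :
    ∃ c : AbelianCocycle k G, c.emImage = q.toFun := by
  obtain ⟨s, hs⟩ := exists_sqrt_hom hG
  refine ⟨{ ψ := fun _ _ _ => 1
            Ω := fun g h => q.polar (s g) h
            ψ_one_left := fun _ _ => rfl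
            ψ_one_mid := fun _ _ => rfl
            ψ_one_right := fun _ _ => rfl
            Ω_one_left := fun g => by simp
            Ω_one_right := fun g => by simp
            coboundary_eq_one := fun _ _ _ _ => by simp
            cocycle_left := fun _ _ _ => by simp [mul_comm]
            cocycle_right := fun _ _ _ => by simp }, funext fun g => ?_⟩
  change q.polar (s g) g = q.toFun g
  nth_rw 3 [← hs g]
  nth_rw 2 [← hs g]
  rw [q.map_mul, _root_.map_mul, q.polar_self]

end QuadForm

end QuadraticForms

/-! ### Recovering `(q, η, g₀)` from `q η` and `g₀⁻²` -/

section QuadraticForms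

variable {k G : Type u} [Field k] [CommGroup G]

theorem MonoidHom.eq_one_of_mul_self {M : Type*} [CommGroup M]
    (hG : ∀ g : G, ∃ h : G, h * h = g) {χ : G →* M} (h : ∀ g, χ g * χ g = 1) : χ = 1 := by
  ext g
  obtain ⟨x, rfl⟩ := hG g
  rw [_root_.map_mul, h, MonoidHom.one_apply]

namespace WRQF

theorem η_apply (x : WRQF k G) (g : G) : x.η g = x.q.polar g x.pt := x.represents g

theorem total_mul (x : WRQF k G) (g h : G) :
    x.total (g * h) = x.total g * x.total h * x.q.polar g h := by
  simp only [total, x.q.map_mul, _root_.map_mul]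
  ac_rfl

/-- Completing the square gives `q(g) η(g) = q(g g₀) q(g₀)⁻¹`. The substitution `g ↦ g⁻¹ g₀⁻²`
inverts `g g₀`, and `q` is even. -/
theorem total_inv_mul (x : WRQF k G) (g : G) :
    x.total (g⁻¹ * x.pt ^ (-2 : ℤ)) = x.total g := by
  have h : g⁻¹ * x.pt ^ (-2 : ℤ) = (g * (x.pt * x.pt))⁻¹ := by
    rw [zpow_neg, zpow_two, mul_inv g]
  rw [h, total, total, map_inv, ← x.q.symm]
  simp only [η_apply, x.q.map_mul, _root_.map_mul, x.q.polar_self]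
  rw [mul_inv_eq_iff_eq_mul]
  ac_rfl

/-- The product `q η` determines `q`. -/
theorem q_eq_of_total_eq (hG : ∀ g : G, ∃ h : G, h * h = g) {x y : WRQF k G} (f : G ≃* G)
    (h : ∀ g, x.total g = y.total (f g)) (g : G) : x.q.toFun g = y.q.toFun (f g) := by
  -- Dividing the value of `q η` at `g` by that at `g⁻¹` cancels the even factor `q` and leaves
  -- `η(g)²`.
  have key : x.η / y.η.comp f.toMonoidHom = 1 := by
    refine MonoidHom.eq_one_of_mul_self hG fun g => ?_
    have h₁ := h g
    have h₂ := h g⁻¹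
    simp only [total, map_inv, ← x.q.symm, ← y.q.symm] at h₁ h₂
    have h₃ := congrArg₂ (· / ·) h₁ h₂
    simp only [mul_div_mul_left_eq_div, div_inv_eq_mul] at h₃
    simp only [MonoidHom.div_apply, MonoidHom.comp_apply, MulEquiv.toMonoidHom_eq_coe,
      MonoidHom.coe_coe]
    rw [div_mul_div_comm, h₃, div_self']
  have h₁ : x.η g = y.η (f g) := div_eq_one.mp (DFunLike.congr_fun key g)
  have h₂ := h g
  rw [total, total, h₁] at h₂
  exact mul_right_cancel h₂

/-- A function with the polar form of `q` and a suitable symmetry comes from a weak representable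
quadratic form. -/
theorem exists_of_total (hG : ∀ g : G, ∃ h : G, h * h = g) (q : QuadForm k G) (t : G → kˣ) (p : G)
    (hmul : ∀ g h, t (g * h) = t g * t h * q.polar g h) (hinv : ∀ g, t (g⁻¹ * p) = t g) :
    ∃ x : WRQF k G, x.q = q ∧ x.total = t ∧ x.pt ^ (-2 : ℤ) = p := by
  -- The condition `g₀⁻² = p` forces `g₀`, and the equal polar forms of `t` and `q` make `η = t / q`
  -- a character.
  obtain ⟨g₀, hg₀⟩ := hG p⁻¹
  let η : G →* kˣ := MonoidHom.mk' (fun g => t g * (q.toFun g)⁻¹) fun a b => by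
    rw [hmul, q.map_mul, mul_inv, mul_inv]
    rw [show t a * t b * q.polar a b * ((q.toFun a)⁻¹ * (q.toFun b)⁻¹ * (q.polar a b)⁻¹) =
      (t a * (q.toFun a)⁻¹) * (t b * (q.toFun b)⁻¹) * (q.polar a b * (q.polar a b)⁻¹) by ac_rfl,
      mul_inv_cancel, mul_one]
  have ht : ∀ g, t g = q.toFun g * η g := fun g => by
    change t g = q.toFun g * (t g * (q.toFun g)⁻¹)
    rw [mul_comm, inv_mul_cancel_right]
  have hp : t p = 1 := by
    have := hinv 1
    rw [inv_one, one_mul, ht 1, q.map_one, map_one, one_mul] at this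
    exact this
  -- Expanding `t(g⁻¹ p) = t(g)` with `t(p) = 1` gives `η(g)² = β_q(g, p⁻¹)`, and `p⁻¹ = g₀²`. The
  -- squares are removed afterwards by `MonoidHom.eq_one_of_mul_self`.
  have hη : ∀ g, η g * η g = q.polar g g₀ * q.polar g g₀ := fun g => by
    have h₁ := hinv g
    rw [hmul, hp, mul_one, ht, ht g, ← q.symm, map_inv, map_inv, MonoidHom.inv_apply, mul_assoc]
      at h₁
    have h₂ := mul_left_cancel h₁
    rw [← map_mul (q.polar g), hg₀, map_inv]
    exact (inv_mul_eq_iff_eq_mul.mp h₂).symm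
  have key : η / q.polar.flip g₀ = 1 := MonoidHom.eq_one_of_mul_self hG fun g => by
    rw [MonoidHom.div_apply, div_mul_div_comm, hη]
    exact div_self' _
  refine ⟨⟨q, η, g₀, fun g => ?_⟩, rfl, funext fun g => (ht g).symm, ?_⟩
  · exact div_eq_one.mp (DFunLike.congr_fun key g)
  · change g₀ ^ (-2 : ℤ) = p
    rw [zpow_neg, zpow_two, hg₀, inv_inv]

end WRQF

end QuadraticForms

namespace GVect

open TensorProduct DirectSum

variable {k G : Type u} [Field k]

/-! ### One-dimensional objects -/

/-- The object `V` is one-dimensional, spanned by the vector `v` of degree `g`. -/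
structure IsLine (V : GVect k G) {g : G} (v : V.comp g) : Prop where
  eq_zero : ∀ {a}, a ≠ g → ∀ x : V.comp a, x = 0
  span : ∀ x : V.comp g, ∃ r : k, x = r • v
  ne_zero : v ≠ 0

theorem isLine_simple (g : G) : IsLine (simple (k := k) g) (simpleOne g) where
  eq_zero h x := simple_eq_zero h x
  span x := ⟨_, simple_eq_smul x⟩
  ne_zero h := by simpa using congrArg (simpleCoeff (k := k) g g) h

/-- A morphism and its inverse, in a fixed degree. -/
theorem iso_hom_inv_app {V W : GVect k G} (φ : V ≅ W) {g : G} (v : V.comp g) :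
    φ.inv.app g (φ.hom.app g v) = v :=
  congrArg (fun t : V ⟶ V => t.app g v) φ.hom_inv_id

theorem iso_inv_hom_app {V W : GVect k G} (φ : V ≅ W) {g : G} (w : W.comp g) :
    φ.hom.app g (φ.inv.app g w) = w :=
  iso_hom_inv_app φ.symm w

theorem exists_dual_eq_one {M : Type*} [AddCommGroup M] [Module k M] {v : M} (hv : v ≠ 0) :
    ∃ φ : M →ₗ[k] k, φ v = 1 := by
  obtain ⟨φ, hφ⟩ := Module.Projective.exists_dual_ne_zero k hv
  exact ⟨(φ v)⁻¹ • φ, by simp [hφ]⟩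

theorem shift_of_ne (V : GVect k G) {a b : G} (h : a ≠ b) : V.shift a b = 0 := by
  simp [shift, h]

namespace IsLine

variable {V W : GVect k G} {g h : G} {v : V.comp g} {w : W.comp h}

theorem map (hv : IsLine V v) (φ : V ≅ W) : IsLine W (φ.hom.app g v) where
  eq_zero ha x := by rw [← iso_inv_hom_app φ x, hv.eq_zero ha (φ.inv.app _ x), map_zero]
  span x := by
    obtain ⟨r, hr⟩ := hv.span (φ.inv.app g x)
    exact ⟨r, by rw [← map_smul, ← hr, iso_inv_hom_app]⟩
  ne_zero h := hv.ne_zero (by rw [← iso_hom_inv_app φ v, h, map_zero])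

theorem degree_unique (hv : IsLine V v) {v' : V.comp h} (hv' : IsLine V v') : g = h := by
  by_contra hne
  exact hv.ne_zero (hv'.eq_zero hne v)

theorem degree_eq (hv : IsLine V v) (hw : IsLine W w) (φ : V ≅ W) : g = h :=
  (hv.map φ).degree_unique hw

theorem smul_injective (hv : IsLine V v) {r s : k} (h : r • v = s • v) : r = s := by
  rw [← sub_eq_zero, ← sub_smul] at h
  exact sub_eq_zero.mp ((smul_eq_zero.mp h).resolve_right hv.ne_zero)

/-- An isomorphism between lines is given by a nonzero scalar. -/
theorem exists_unit {w : W.comp g} (hv : IsLine V v) (hw : IsLine W w) (φ : V ≅ W) :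
    ∃ r : kˣ, φ.hom.app g v = (r : k) • w := by
  obtain ⟨r, hr⟩ := hw.span (φ.hom.app g v)
  refine ⟨Units.mk0 r fun h => (hv.map φ).ne_zero ?_, hr⟩
  rw [hr, h, zero_smul]

theorem hom_ext {f f' : V ⟶ W} (hv : IsLine V v) (h : f.app g v = f'.app g v) : f = f' := by
  ext a x
  by_cases ha : a = g
  · subst ha
    obtain ⟨r, rfl⟩ := hv.span x
    rw [map_smul, map_smul, h]
  · rw [hv.eq_zero ha x, map_zero, map_zero]

/-- A line is simple. -/
theorem exists_iso (hv : IsLine V v) : ∃ φ : simple g ≅ V, φ.hom.app g (simpleOne g) = v := by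
  obtain ⟨φ, hφ⟩ := exists_dual_eq_one (k := k) hv.ne_zero
  refine ⟨⟨fromSimple v, ⟨fun a => (φ ∘ₗ V.shift a g).smulRight
    ((simple g).shift g a (simpleOne g))⟩, ?_, ?_⟩, fromSimple_one v⟩
  · exact (isLine_simple g).hom_ext (by simp [hφ])
  · exact hv.hom_ext (by simp [hφ])

end IsLine

/-- An object with only scalar endomorphisms is a line. -/
theorem exists_isLine_of_end (V : GVect k G) (h0 : 𝟙 V ≠ 0)
    (hend : ∀ f : V ⟶ V, ∃ r : k, f = r • 𝟙 V) : ∃ (g : G) (v : V.comp g), IsLine V v := by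
  obtain ⟨h, v, hv⟩ : ∃ (h : G) (v : V.comp h), v ≠ 0 := by
    by_contra! hc
    exact h0 (by ext g v; exact hc g v)
  obtain ⟨φ, hφ⟩ := exists_dual_eq_one (k := k) hv
  -- The rank-one endomorphism `x ↦ φ(x) v` of `V_h`, extended by zero, must be a scalar. It fixes
  -- `v`, so it is the identity.
  obtain ⟨r, hr⟩ := hend ⟨fun a => (φ ∘ₗ V.shift a h).smulRight (V.shift h a v)⟩
  have key : ∀ a (x : V.comp a), φ (V.shift a h x) • V.shift h a v = r • x := fun a x =>
    congrArg (fun f : V ⟶ V => f.app a x) hr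
  obtain rfl : r = 1 := by
    have : (1 : k) • v = r • v := by simpa [hφ] using key h v
    rw [← sub_eq_zero, ← sub_smul] at this
    exact (sub_eq_zero.mp ((smul_eq_zero.mp this).resolve_right hv)).symm
  refine ⟨h, v, fun {a} ha x => ?_, fun x => ⟨φ x, ?_⟩, hv⟩
  · simpa [shift_of_ne V ha] using (key a x).symm
  · simpa using (key h x).symm

variable [CommGroup G] [Finite G]

theorem incl_injective (V W : GVect k G) {h l g : G} (e : h * l = g) :
    Function.Injective (incl V W h l e) := by
  classical
  exact DirectSum.of_injective (β := fun p : Pairs g => V.comp p.1.1 ⊗[k] W.comp p.1.2)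
    (⟨(h, l), e⟩ : Pairs g)

theorem IsLine.tensor {V W : GVect k G} {h l g : G} {v : V.comp h} {w : W.comp l}
    (hv : IsLine V v) (hw : IsLine W w) (e : h * l = g) :
    IsLine (tensor V W) (incl V W h l e (v ⊗ₜ w)) where
  eq_zero {a} ha x := by
    have : (LinearMap.id : (GVect.tensor V W).comp a →ₗ[k] _) = 0 := tensor_ext fun b c e' x y => by
      by_cases hb : b = h
      · have hc : c ≠ l := by rintro rfl; subst hb; exact ha (e'.symm.trans e)
        simp [hw.eq_zero hc y]
      · simp [hv.eq_zero hb x]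
    exact LinearMap.congr_fun this x
  span x := by
    -- Spanning is restated as the vanishing of the quotient map, which can be checked on pure
    -- tensors.
    have : (Submodule.span k {incl V W h l e (v ⊗ₜ w)}).mkQ = 0 :=
      tensor_ext fun b c e' x y => by
        rw [LinearMap.zero_apply, Submodule.mkQ_apply, Submodule.Quotient.mk_eq_zero]
        by_cases hb : b = h
        · subst hb
          obtain rfl : c = l := mul_left_cancel (e'.trans e.symm)
          obtain ⟨r, rfl⟩ := hv.span x
          obtain ⟨s, rfl⟩ := hw.span y
          rw [TensorProduct.smul_tmul_smul, map_smul]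
          exact Submodule.smul_mem _ _ (Submodule.mem_span_singleton_self _)
        · rw [hv.eq_zero hb x, TensorProduct.zero_tmul, map_zero]
          exact Submodule.zero_mem _
    have hx := LinearMap.congr_fun this x
    rw [LinearMap.zero_apply, Submodule.mkQ_apply, Submodule.Quotient.mk_eq_zero,
      Submodule.mem_span_singleton] at hx
    exact hx.imp fun _ => Eq.symm
  ne_zero h := by
    rw [map_eq_zero_iff _ (incl_injective V W e)] at h
    obtain ⟨φ, hφ⟩ := exists_dual_eq_one (k := k) hv.ne_zero
    obtain ⟨χ, hχ⟩ := exists_dual_eq_one (k := k) hw.ne_zero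
    simpa [hφ, hχ] using congrArg ((TensorProduct.lid k k).toLinearMap ∘ₗ TensorProduct.map φ χ) h

end GVect

namespace GVect

open TensorProduct DirectSum

variable {k G : Type u} [Field k] [CommGroup G] [Finite G]

/-! ### Structure isomorphisms and cocycles -/

theorem incl_right_congr {V W U : GVect k G} {h l c b g : G} (e' : l * c = b) (e : h * b = g)
    (v : V.comp h) (t : W.comp l ⊗[k] U.comp c) :
    incl V (tensor W U) h b e (v ⊗ₜ incl W U l c e' t) =
      incl V (tensor W U) h (l * c) (by rw [e', e]) (v ⊗ₜ incl W U l c rfl t) := by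
  subst e'; rfl

theorem incl_left_congr {V W U : GVect k G} {h l c a g : G} (e' : h * l = a) (e : a * c = g)
    (t : V.comp h ⊗[k] W.comp l) (u : U.comp c) :
    incl (tensor V W) U a c e (incl V W h l e' t ⊗ₜ u) =
      incl (tensor V W) U (h * l) c (by rw [e', e]) (incl V W h l rfl t ⊗ₜ u) := by
  subst e'; rfl

theorem incl_shift_left {V W : GVect k G} {h h' l g : G} (hh : h = h') (e : h' * l = g)
    (v : V.comp h) (w : W.comp l) :
    incl V W h' l e (V.shift h h' v ⊗ₜ w) = incl V W h l (by rw [hh, e]) (v ⊗ₜ w) := by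
  subst hh; simp

theorem incl_shift_right {V W : GVect k G} {h l l' g : G} (hl : l = l') (e : h * l' = g)
    (v : V.comp h) (w : W.comp l) :
    incl V W h l' e (v ⊗ₜ W.shift l l' w) = incl V W h l (by rw [hl, e]) (v ⊗ₜ w) := by
  subst hl; simp

/-- The vector `w ⊗ (x ⊗ (y ⊗ z))`. -/
noncomputable def incl₄ {W X Y Z : GVect k G} {h l c d g : G} (e : h * (l * (c * d)) = g)
    (w : W.comp h) (x : X.comp l) (y : Y.comp c) (z : Z.comp d) :
    (tensor W (tensor X (tensor Y Z))).comp g :=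
  incl W _ h (l * (c * d)) e (w ⊗ₜ incl X _ l (c * d) rfl (x ⊗ₜ incl Y Z c d rfl (y ⊗ₜ z)))

theorem incl₄_eq {W X Y Z : GVect k G} {h l c d m n g : G} (e : c * d = m) (e' : l * m = n)
    (e'' : h * n = g) (w : W.comp h) (x : X.comp l) (y : Y.comp c) (z : Z.comp d) :
    incl W _ h n e'' (w ⊗ₜ incl X _ l m e' (x ⊗ₜ incl Y Z c d e (y ⊗ₜ z))) =
      incl₄ (by rw [e, e', e'']) w x y z := by
  subst e e'; rfl

theorem hom_ext_tensor_left₄ {W X Y Z V : GVect k G}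
    {f f' : tensor (tensor (tensor W X) Y) Z ⟶ V}
    (H : ∀ (g h l c d : G) (e : h * l * c * d = g) (w : W.comp h) (x : X.comp l) (y : Y.comp c)
      (z : Z.comp d),
      f.app g (incl _ Z (h * l * c) d e
        (incl _ Y (h * l) c rfl (incl W X h l rfl (w ⊗ₜ x) ⊗ₜ y) ⊗ₜ z)) =
      f'.app g (incl _ Z (h * l * c) d e
        (incl _ Y (h * l) c rfl (incl W X h l rfl (w ⊗ₜ x) ⊗ₜ y) ⊗ₜ z))) : f = f' := by
  refine hom_ext_tensor_left fun g a c d e t y z => ?_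
  have : f.app g ∘ₗ incl _ Z _ d e ∘ₗ (TensorProduct.mk k _ _).flip z ∘ₗ
      incl (tensor W X) Y a c rfl ∘ₗ (TensorProduct.mk k _ _).flip y =
      f'.app g ∘ₗ incl _ Z _ d e ∘ₗ (TensorProduct.mk k _ _).flip z ∘ₗ
      incl (tensor W X) Y a c rfl ∘ₗ (TensorProduct.mk k _ _).flip y :=
    tensor_ext fun h l e' w x => by subst e'; exact H g h l c d e w x y z
  exact LinearMap.congr_fun this t

theorem assocHom_naturality (ψ : G → G → G → kˣ) {X X' Y Y' Z Z' : GVect k G} (f : X ⟶ X')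
    (g : Y ⟶ Y') (h : Z ⟶ Z') : tensorMap (tensorMap f g) h ≫ assocHom ψ X' Y' Z' =
      assocHom ψ X Y Z ≫ tensorMap f (tensorMap g h) :=
  hom_ext_tensor_left fun _ _ _ _ _ _ _ _ => by simp

theorem braidHom_naturality (Ω : G → G → kˣ) {X X' Y Y' : GVect k G} (f : X ⟶ X')
    (g : Y ⟶ Y') : tensorMap f g ≫ braidHom Ω X' Y' = braidHom Ω X Y ≫ tensorMap g f :=
  hom_ext_tensor fun _ _ _ _ _ _ => by simp

theorem pentagon_incl_left (ψ : G → G → G → kˣ) {W X Y Z : GVect k G} {g h l c d : G}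
    (e : h * l * c * d = g) (w : W.comp h) (x : X.comp l) (y : Y.comp c) (z : Z.comp d) :
    (tensorMap (assocHom ψ W X Y) (𝟙 Z) ≫ assocHom ψ W (tensor X Y) Z ≫
      tensorMap (𝟙 W) (assocHom ψ X Y Z)).app g (incl _ Z (h * l * c) d e
        (incl _ Y (h * l) c rfl (incl W X h l rfl (w ⊗ₜ x) ⊗ₜ y) ⊗ₜ z)) =
      ((ψ h l c * ψ h (l * c) d * ψ l c d : kˣ) : k) •
        incl₄ (by rw [← e]; simp only [mul_assoc]) w x y z := by
  simp [← TensorProduct.smul_tmul', smul_smul, incl₄_eq]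

theorem pentagon_incl_right (ψ : G → G → G → kˣ) {W X Y Z : GVect k G} {g h l c d : G}
    (e : h * l * c * d = g) (w : W.comp h) (x : X.comp l) (y : Y.comp c) (z : Z.comp d) :
    (assocHom ψ (tensor W X) Y Z ≫ assocHom ψ W X (tensor Y Z)).app g (incl _ Z (h * l * c) d e
        (incl _ Y (h * l) c rfl (incl W X h l rfl (w ⊗ₜ x) ⊗ₜ y) ⊗ₜ z)) =
      ((ψ (h * l) c d * ψ h l (c * d) : kˣ) : k) •
        incl₄ (by rw [← e]; simp only [mul_assoc]) w x y z := by
  simp [smul_smul, incl₄_eq]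

/-- Both composites send a pure tensor of homogeneous vectors to multiples of one common vector. On
simple objects that vector spans a line, so the scalars must agree; conversely pure tensors
generate. The equivalences for the other axioms follow the same pattern. -/
theorem pentagon_iff (ψ : G → G → G → kˣ) :
    (∀ W X Y Z : GVect k G, tensorMap (assocHom ψ W X Y) (𝟙 Z) ≫ assocHom ψ W (tensor X Y) Z ≫
      tensorMap (𝟙 W) (assocHom ψ X Y Z) =
        assocHom ψ (tensor W X) Y Z ≫ assocHom ψ W X (tensor Y Z)) ↔
    ∀ h l c d, ψ h l c * ψ h (l * c) d * ψ l c d = ψ (h * l) c d * ψ h l (c * d) := by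
  refine ⟨fun H h l c d => Units.ext ?_, fun H W X Y Z => ?_⟩
  · refine ((isLine_simple h).tensor ((isLine_simple l).tensor ((isLine_simple c).tensor
      (isLine_simple (k := k) d) rfl) rfl) (g := h * l * c * d)
      (by simp only [mul_assoc])).smul_injective ?_
    refine (pentagon_incl_left ψ rfl _ _ _ _).symm.trans (Eq.trans ?_
      (pentagon_incl_right ψ rfl _ _ _ _))
    rw [H]
  · refine hom_ext_tensor_left₄ fun g h l c d e w x y z => ?_
    rw [pentagon_incl_left, pentagon_incl_right, H]

theorem hexagon_forward_iff (ψ : G → G → G → kˣ) (Ω : G → G → kˣ) :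
    (∀ X Y Z : GVect k G, assocHom ψ X Y Z ≫ braidHom Ω X (tensor Y Z) ≫ assocHom ψ Y Z X =
      tensorMap (braidHom Ω X Y) (𝟙 Z) ≫ assocHom ψ Y X Z ≫ tensorMap (𝟙 Y) (braidHom Ω X Z)) ↔
    ∀ h l c, ψ h l c * Ω (l * c) h * ψ l c h = Ω l h * ψ l h c * Ω c h := by
  have key (X Y Z : GVect k G) (g h l c : G) (e : h * l * c = g) (x : X.comp h) (y : Y.comp l)
      (z : Z.comp c) :
      (assocHom ψ X Y Z ≫ braidHom Ω X (tensor Y Z) ≫ assocHom ψ Y Z X).app g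
        (incl _ Z (h * l) c e (incl X Y h l rfl (x ⊗ₜ y) ⊗ₜ z)) =
      ((ψ h l c * Ω (l * c) h * ψ l c h : kˣ) : k) • incl Y (tensor Z X) l (c * h)
        (by rw [← e]; ac_rfl) (y ⊗ₜ incl Z X c h rfl (z ⊗ₜ x)) ∧
      (tensorMap (braidHom Ω X Y) (𝟙 Z) ≫ assocHom ψ Y X Z ≫ tensorMap (𝟙 Y) (braidHom Ω X Z)).app g
        (incl _ Z (h * l) c e (incl X Y h l rfl (x ⊗ₜ y) ⊗ₜ z)) =
      ((Ω l h * ψ l h c * Ω c h : kˣ) : k) • incl Y (tensor Z X) l (c * h)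
        (by rw [← e]; ac_rfl) (y ⊗ₜ incl Z X c h rfl (z ⊗ₜ x)) := by
    constructor
    · simp [smul_smul, mul_assoc]
    · simp [smul_smul, ← TensorProduct.smul_tmul', mul_assoc]
      rw [incl_right_congr]
  refine ⟨fun H h l c => Units.ext ?_, fun H X Y Z => ?_⟩
  · refine ((isLine_simple l).tensor ((isLine_simple c).tensor (isLine_simple (k := k) h) rfl)
      (g := h * l * c) (by ac_rfl)).smul_injective ?_
    obtain ⟨h₁, h₂⟩ := key _ _ _ _ h l c rfl (simpleOne h) (simpleOne l) (simpleOne c)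
    rw [← h₁, ← h₂, H]
  · refine hom_ext_tensor_left fun g h l c e x y z => ?_
    obtain ⟨h₁, h₂⟩ := key _ _ _ _ h l c e x y z
    rw [h₁, h₂, H]

theorem hexagon_reverse_iff (ψ : G → G → G → kˣ) (Ω : G → G → kˣ) :
    (∀ X Y Z : GVect k G, assocInv ψ X Y Z ≫ braidHom Ω (tensor X Y) Z ≫ assocInv ψ Z X Y =
      tensorMap (𝟙 X) (braidHom Ω Y Z) ≫ assocInv ψ X Z Y ≫ tensorMap (braidHom Ω X Z) (𝟙 Y)) ↔
    ∀ h l c, (ψ h l c)⁻¹ * Ω c (h * l) * (ψ c h l)⁻¹ = Ω c l * (ψ h c l)⁻¹ * Ω c h := by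
  have key (X Y Z : GVect k G) (g h l c : G) (e : h * (l * c) = g) (x : X.comp h) (y : Y.comp l)
      (z : Z.comp c) :
      (assocInv ψ X Y Z ≫ braidHom Ω (tensor X Y) Z ≫ assocInv ψ Z X Y).app g
        (incl X _ h (l * c) e (x ⊗ₜ incl Y Z l c rfl (y ⊗ₜ z))) =
      (((ψ h l c)⁻¹ * Ω c (h * l) * (ψ c h l)⁻¹ : kˣ) : k) • incl (tensor Z X) Y (c * h) l
        (by rw [← e]; ac_rfl) (incl Z X c h rfl (z ⊗ₜ x) ⊗ₜ y) ∧
      (tensorMap (𝟙 X) (braidHom Ω Y Z) ≫ assocInv ψ X Z Y ≫ tensorMap (braidHom Ω X Z) (𝟙 Y)).app g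
        (incl X _ h (l * c) e (x ⊗ₜ incl Y Z l c rfl (y ⊗ₜ z))) =
      ((Ω c l * (ψ h c l)⁻¹ * Ω c h : kˣ) : k) • incl (tensor Z X) Y (c * h) l
        (by rw [← e]; ac_rfl) (incl Z X c h rfl (z ⊗ₜ x) ⊗ₜ y) := by
    constructor
    · simp [smul_smul, mul_assoc]
    · simp [smul_smul, ← TensorProduct.smul_tmul', mul_assoc]
      rw [incl_left_congr]
  refine ⟨fun H h l c => Units.ext ?_, fun H X Y Z => ?_⟩
  · refine (((isLine_simple c).tensor (isLine_simple h) rfl).tensor (isLine_simple (k := k) l)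
      (g := h * (l * c)) (by ac_rfl)).smul_injective ?_
    obtain ⟨h₁, h₂⟩ := key _ _ _ _ h l c rfl (simpleOne h) (simpleOne l) (simpleOne c)
    rw [← h₁, ← h₂, H]
  · refine hom_ext_tensor_right fun g h l c e x y z => ?_
    obtain ⟨h₁, h₂⟩ := key _ _ _ _ h l c e x y z
    rw [h₁, h₂, H]

theorem triangle_iff (ψ : G → G → G → kˣ) :
    (∀ X Y : GVect k G, assocHom ψ X (simple 1) Y ≫ tensorMap (𝟙 X) (leftUnitHom Y) =
      tensorMap (rightUnitHom X) (𝟙 Y)) ↔ ∀ h c, ψ h 1 c = 1 := by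
  have key (X Y : GVect k G) (g h c : G) (e : h * 1 * c = g) (x : X.comp h) (y : Y.comp c) :
      (assocHom ψ X (simple 1) Y ≫ tensorMap (𝟙 X) (leftUnitHom Y)).app g
        (incl _ Y (h * 1) c e (incl X _ h 1 rfl (x ⊗ₜ simpleOne 1) ⊗ₜ y)) =
      ((ψ h 1 c : kˣ) : k) • incl X Y h c (by rw [← e, mul_one]) (x ⊗ₜ y) ∧
      (tensorMap (rightUnitHom X) (𝟙 Y)).app g
        (incl _ Y (h * 1) c e (incl X _ h 1 rfl (x ⊗ₜ simpleOne 1) ⊗ₜ y)) =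
      ((1 : kˣ) : k) • incl X Y h c (by rw [← e, mul_one]) (x ⊗ₜ y) := by
    constructor
    · simp [incl_shift_right (one_mul c).symm]
    · simp [incl_shift_left (mul_one h).symm]
  refine ⟨fun H h c => Units.ext ?_, fun H X Y => ?_⟩
  · refine ((isLine_simple h).tensor (isLine_simple (k := k) c)
      (g := h * 1 * c) (by rw [mul_one])).smul_injective ?_
    obtain ⟨h₁, h₂⟩ := key _ _ _ h c rfl (simpleOne h) (simpleOne c)
    rw [← h₁, ← h₂, H]
  · refine hom_ext_tensor_left fun g h l c e x s y => ?_
    by_cases hl : l = 1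
    · subst hl
      rw [simple_eq_smul s]
      obtain ⟨h₁, h₂⟩ := key _ _ _ h c e x y
      simp only [TensorProduct.tmul_smul, ← TensorProduct.smul_tmul', map_smul]
      rw [h₁, h₂, H]
    · simp [simple_eq_zero hl s]

theorem twist_tensor_iff (Ω : G → G → kˣ) (t : G → kˣ) :
    (∀ X Y : GVect k G, (twistIso t).hom.app (tensor X Y) = braidHom Ω X Y ≫ braidHom Ω Y X ≫
      tensorMap ((twistIso t).hom.app X) ((twistIso t).hom.app Y)) ↔
    ∀ h l, t (h * l) = t h * t l * (Ω h l * Ω l h) := by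
  have key (X Y : GVect k G) (g h l : G) (e : h * l = g) (x : X.comp h) (y : Y.comp l) :
      (braidHom Ω X Y ≫ braidHom Ω Y X ≫
      tensorMap ((twistIso t).hom.app X) ((twistIso t).hom.app Y)).app g
        (incl X Y h l e (x ⊗ₜ y)) =
      ((t h * t l * (Ω h l * Ω l h) : kˣ) : k) • incl X Y h l e (x ⊗ₜ y) := by
    simp [twistIso, ← TensorProduct.smul_tmul', smul_smul]
    congr 1
    ring
  have key' (X : GVect k G) (g : G) (x : X.comp g) :
      Hom.app ((twistIso t).hom.app X) g x = (t g : k) • x := rfl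
  refine ⟨fun H h l => Units.ext ?_, fun H X Y => ?_⟩
  · refine ((isLine_simple h).tensor (isLine_simple (k := k) l) rfl).smul_injective ?_
    rw [← key, ← H]
    exact (key' _ _ _).symm
  · refine hom_ext_tensor fun g h l e x y => ?_
    rw [key, ← H]
    subst e
    exact key' _ _ _

omit [Finite G] in
theorem twist_dual_iff (t : G → kˣ) (p : G) :
    (∀ X : GVect k G, (dualFunctor p).map ((twistIso t).hom.app X).op =
      (twistIso t).hom.app ((dualFunctor p).obj (Opposite.op X))) ↔
    ∀ g, t (g⁻¹ * p) = t g := by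
  have key₁ (X : GVect k G) (g : G) (φ : ((dualFunctor p).obj (Opposite.op X)).comp g) :
      Hom.app ((dualFunctor p).map ((twistIso t).hom.app X).op) g φ = (t (g⁻¹ * p) : k) • φ :=
    LinearMap.ext fun x => LinearMap.map_smul (show X.comp (g⁻¹ * p) →ₗ[k] k from φ) _ x
  have key₂ (X : GVect k G) (g : G) (φ : ((dualFunctor p).obj (Opposite.op X)).comp g) :
      Hom.app ((twistIso t).hom.app ((dualFunctor p).obj (Opposite.op X))) g φ = (t g : k) • φ :=
    rfl
  refine ⟨fun H g => Units.ext ?_, fun H X => ?_⟩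
  -- The test object is the simple one whose dual lives in degree `g`; both sides are evaluated on
  -- its coordinate functional.
  · have h := (key₂ (simple (g⁻¹ * p)) g (simpleCoeff _ _)).symm.trans
      ((congrArg (fun f => Hom.app f g (simpleCoeff _ _)) (H (simple (g⁻¹ * p)))).symm.trans
        (key₁ (simple (g⁻¹ * p)) g (simpleCoeff _ _)))
    have := LinearMap.congr_fun (M := (simple (k := k) (g⁻¹ * p)).comp (g⁻¹ * p)) (M₃ := k) h
      (simpleOne (g⁻¹ * p))
    change (t g : k) * 1 = (t (g⁻¹ * p) : k) * 1 at this
    simpa using this.symm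
  · ext g : 1
    refine LinearMap.ext fun φ => ?_
    rw [key₁, key₂, H]

end GVect

/-! ### The weak ribbon axioms for structures given by functions -/

variable {k G : Type u} [Field k] [CommGroup G] [Finite G]

/-- The candidate `(α_ψ, γ_Ω, θ_t, p)` for arbitrary functions. -/
noncomputable def RibbonData.ofFun (ψ : G → G → G → kˣ) (Ω : G → G → kˣ) (t : G → kˣ) (p : G) :
    RibbonData k G where
  assoc := GVect.assocIso ψ
  braid := GVect.braidIso Ω
  twist := GVect.twistIso t
  pt := p

theorem RibbonData.ofFun_isWeakRibbon_iff (ψ : G → G → G → kˣ) (Ω : G → G → kˣ) (t : G → kˣ)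
    (p : G) : (RibbonData.ofFun ψ Ω t p).IsWeakRibbon ↔
      (∀ h l c d, ψ h l c * ψ h (l * c) d * ψ l c d = ψ (h * l) c d * ψ h l (c * d)) ∧
      (∀ h c, ψ h 1 c = 1) ∧
      (∀ h l c, ψ h l c * Ω (l * c) h * ψ l c h = Ω l h * ψ l h c * Ω c h) ∧
      (∀ h l c, (ψ h l c)⁻¹ * Ω c (h * l) * (ψ c h l)⁻¹ = Ω c l * (ψ h c l)⁻¹ * Ω c h) ∧
      (∀ h l, t (h * l) = t h * t l * (Ω h l * Ω l h)) ∧ ∀ g, t (g⁻¹ * p) = t g := by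
  rw [← GVect.pentagon_iff, ← GVect.triangle_iff, ← GVect.hexagon_forward_iff,
    ← GVect.hexagon_reverse_iff, ← GVect.twist_tensor_iff, ← GVect.twist_dual_iff]
  exact ⟨fun H => ⟨H.pentagon, H.triangle, H.hexagon_forward, H.hexagon_reverse, H.twist_tensor,
    H.twist_dual⟩, fun ⟨h₁, h₂, h₃, h₄, h₅, h₆⟩ => ⟨GVect.assocHom_naturality ψ, h₁, h₂,
      GVect.braidHom_naturality Ω, h₃, h₄, h₅, h₆⟩⟩

/-! ### Natural isomorphisms are given by scalars -/

namespace GVect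

open TensorProduct DirectSum

variable {k G : Type u} [Field k]

/-- A natural automorphism of the identity functor is given by scalars. -/
theorem exists_eq_twistIso (θ : 𝟭 (GVect k G) ≅ 𝟭 (GVect k G)) : ∃ t : G → kˣ, θ = twistIso t := by
  choose t ht using fun g => (isLine_simple (k := k) g).exists_unit (isLine_simple g)
    (θ.app (simple g))
  refine ⟨t, Iso.ext (NatTrans.ext (funext fun V => hom_ext fun g => LinearMap.ext fun v => ?_))⟩
  -- A homogeneous `v` is the image of `1_g` under `fromSimple v`, so naturality transports the
  -- scalar from the simple object. The same device determines associators and braidings.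
  have := congrArg (fun f : simple g ⟶ V => f.app g (simpleOne g))
    (θ.hom.naturality (fromSimple v))
  have h₁ : Hom.app (θ.hom.app V) g (Hom.app (fromSimple v) g (simpleOne g)) =
    Hom.app (fromSimple v) g (Hom.app (θ.hom.app (simple g)) g (simpleOne g)) := this
  have h₂ : Hom.app (θ.hom.app (simple g)) g (simpleOne g) = (t g : k) • simpleOne g := ht g
  rw [h₂, map_smul, fromSimple_one] at h₁
  exact h₁

variable [CommGroup G] [Finite G]

/-- A natural associativity isomorphism is given by scalars. -/
theorem exists_eq_assocIso
    (α : ∀ X Y Z : GVect k G, tensor (tensor X Y) Z ≅ tensor X (tensor Y Z))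
    (hα : ∀ {X X' Y Y' Z Z' : GVect k G} (f : X ⟶ X') (g : Y ⟶ Y') (h : Z ⟶ Z'),
      tensorMap (tensorMap f g) h ≫ (α X' Y' Z').hom =
        (α X Y Z).hom ≫ tensorMap f (tensorMap g h)) :
    ∃ ψ : G → G → G → kˣ, α = assocIso ψ := by
  choose ψ hψ using fun g h l : G =>
    (((isLine_simple (k := k) g).tensor (isLine_simple h) rfl).tensor (isLine_simple l)
      rfl).exists_unit ((isLine_simple g).tensor ((isLine_simple h).tensor (isLine_simple l) rfl)
        (mul_assoc g h l).symm) (α _ _ _)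
  refine ⟨ψ, funext fun V => funext fun W => funext fun U => Iso.ext
    (hom_ext_tensor_left fun d g h l e v w u => ?_)⟩
  subst e
  have := congrArg (fun f : tensor (tensor (simple g) (simple h)) (simple l) ⟶
    tensor V (tensor W U) => f.app _ (incl _ _ (g * h) l rfl
      (incl _ _ g h rfl (simpleOne g ⊗ₜ simpleOne h) ⊗ₜ simpleOne l)))
    (hα (fromSimple v) (fromSimple w) (fromSimple u))
  simp only [comp_app, LinearMap.comp_apply, tensorMap_incl, fromSimple_one] at this
  rw [this, hψ, map_smul, tensorMap_incl, tensorMap_incl]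
  simp only [fromSimple_one]
  exact (assocHom_incl ψ V W U g h l rfl rfl v w u).symm

/-- A natural commutativity isomorphism is given by scalars. -/
theorem exists_eq_braidIso (γ : ∀ X Y : GVect k G, tensor X Y ≅ tensor Y X)
    (hγ : ∀ {X X' Y Y' : GVect k G} (f : X ⟶ X') (g : Y ⟶ Y'),
      tensorMap f g ≫ (γ X' Y').hom = (γ X Y).hom ≫ tensorMap g f) :
    ∃ Ω : G → G → kˣ, γ = braidIso Ω := by
  choose Ω hΩ using fun l h : G =>
    ((isLine_simple (k := k) h).tensor (isLine_simple l) rfl).exists_unit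
      ((isLine_simple l).tensor (isLine_simple h) (mul_comm l h)) (γ _ _)
  refine ⟨Ω, funext fun V => funext fun W => Iso.ext
    (hom_ext_tensor fun d h l e v w => ?_)⟩
  subst e
  have := congrArg (fun f : tensor (simple h) (simple l) ⟶ tensor W V => f.app _
    (incl _ _ h l rfl (simpleOne h ⊗ₜ simpleOne l))) (hγ (fromSimple v) (fromSimple w))
  simp only [comp_app, LinearMap.comp_apply, tensorMap_incl, fromSimple_one] at this
  rw [this, hΩ, map_smul, tensorMap_incl]
  simp only [fromSimple_one]
  exact (braidHom_incl Ω V W h l rfl v w).symm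

end GVect

/-! ### Weak ribbon structures come from cocycles and quadratic forms -/

variable {k G : Type u} [Field k] [CommGroup G] [Finite G]

theorem RibbonData.IsWeakRibbon.exists_eq_ofFun {D : RibbonData k G} (hD : D.IsWeakRibbon) :
    ∃ ψ Ω t, D = RibbonData.ofFun ψ Ω t D.pt := by
  obtain ⟨ψ, hψ⟩ := GVect.exists_eq_assocIso D.assoc hD.assoc_naturality
  obtain ⟨Ω, hΩ⟩ := GVect.exists_eq_braidIso D.braid hD.braid_naturality
  obtain ⟨t, ht⟩ := GVect.exists_eq_twistIso D.twist
  obtain ⟨α, γ, θ, p⟩ := D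
  obtain rfl : α = GVect.assocIso ψ := hψ
  obtain rfl : γ = GVect.braidIso Ω := hΩ
  obtain rfl : θ = GVect.twistIso t := ht
  exact ⟨ψ, Ω, t, rfl⟩

theorem pentagon_rearrange {A : Type*} [CommGroup A] (a b c d e : A) :
    a * b⁻¹ * c * d⁻¹ * e = 1 ↔ e * c * a = b * d := by
  rw [show a * b⁻¹ * c * d⁻¹ * e = e * c * a / (b * d) by
    rw [div_eq_mul_inv, mul_inv]; ac_rfl, div_eq_one]

/-- The abelian 3-cocycle of a weak ribbon structure. -/
theorem RibbonData.exists_cocycle {ψ : G → G → G → kˣ} {Ω : G → G → kˣ} {t : G → kˣ} {p : G}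
    (h : (RibbonData.ofFun ψ Ω t p).IsWeakRibbon) :
    ∃ c : AbelianCocycle k G, c.ψ = ψ ∧ c.Ω = Ω := by
  obtain ⟨hp, ht, hf, hr, -, -⟩ := (RibbonData.ofFun_isWeakRibbon_iff ψ Ω t p).mp h
  -- The triangle normalizes `ψ` only in the middle argument; the pentagon at units gives the outer
  -- ones, and the hexagons at units normalize `Ω`.
  have hl : ∀ g l, ψ 1 g l = 1 := fun g l => by
    simpa [ht] using hp 1 1 g l
  have hr' : ∀ g l, ψ g l 1 = 1 := fun g l => by
    simpa [ht] using hp g l 1 1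
  -- Since `γ_Ω` uses `Ω(g₂, g₁)`, the reverse hexagon yields `cocycle_left` and the forward one
  -- `cocycle_right`, with permuted arguments.
  refine ⟨⟨ψ, Ω, hl, ht, hr', fun g => ?_, fun g => ?_, fun a b c d => (pentagon_rearrange ..).mpr (hp a b c d),
    fun a b c => hr b c a, fun a b c => hf c a b⟩, rfl, rfl⟩
  · simpa [ht, hl, hr'] using hf g 1 1
  · simpa [ht, hl, hr'] using hr 1 1 g

theorem RibbonData.of_isWeakRibbon (hG : ∀ g : G, ∃ h : G, h * h = g) (c : AbelianCocycle k G)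
    {x : WRQF k G} (hc : c.emImage = x.q.toFun) :
    (RibbonData.of c x.total (x.pt ^ (-2 : ℤ))).IsWeakRibbon := by
  refine (RibbonData.ofFun_isWeakRibbon_iff c.ψ c.Ω _ _).mpr ⟨fun a b d e =>
    (pentagon_rearrange ..).mp (c.coboundary_eq_one a b d e), c.ψ_one_mid,
    fun h l d => c.cocycle_right l d h, fun h l d => c.cocycle_left d h l, fun g h => ?_,
    x.total_inv_mul⟩
  rw [x.total_mul, x.q.polar_apply, ← hc, c.assocForm_emImage hG]

/-- Every weak ribbon structure comes from a weak representable quadratic form. -/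
theorem RibbonData.IsWeakRibbon.exists_eq_of (hG : ∀ g : G, ∃ h : G, h * h = g)
    {D : RibbonData k G} (hD : D.IsWeakRibbon) :
    ∃ (x : WRQF k G) (c : AbelianCocycle k G), c.emImage = x.q.toFun ∧
      D = RibbonData.of c x.total (x.pt ^ (-2 : ℤ)) := by
  obtain ⟨ψ, Ω, t, h⟩ := hD.exists_eq_ofFun
  rw [h] at hD
  obtain ⟨c, rfl, rfl⟩ := RibbonData.exists_cocycle hD
  obtain ⟨-, -, -, -, h₁, h₂⟩ := (RibbonData.ofFun_isWeakRibbon_iff c.ψ c.Ω t D.pt).mp hD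
  -- The quadratic form is the diagonal of `Ω`. Its polar form is the double braiding, which is also
  -- the polar form of the twist.
  obtain ⟨x, hx, rfl, hp⟩ := WRQF.exists_of_total hG (c.quadForm hG) t D.pt (fun g l => by
    rw [h₁, QuadForm.polar_apply]
    exact congrArg _ (c.assocForm_emImage hG g l).symm) h₂
  refine ⟨x, c, by rw [hx]; rfl, ?_⟩
  rw [hp]
  exact h

namespace GVect

open TensorProduct DirectSum

variable {k G : Type u} [Field k]

/-! ### Regrading along an automorphism -/

theorem shift_shift (V : GVect k G) {a b : G} (h : a = b) (v : V.comp a) :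
    V.shift b a (V.shift a b v) = v := by
  subst h; simp

variable [CommGroup G]

/-- The object `V` with its grading transported along `f`. -/
def regradeObj (f : G ≃* G) (V : GVect k G) : GVect k G where
  comp g := V.comp (f.symm g)

/-- Transport of the grading of a morphism along `f`. -/
def regradeMap (f : G ≃* G) {V W : GVect k G} (φ : V ⟶ W) : regradeObj f V ⟶ regradeObj f W :=
  ⟨fun g => φ.app (f.symm g)⟩

/-- Transport of the grading along `f`. -/
def regrade (f : G ≃* G) : GVect k G ⥤ GVect k G where
  obj := regradeObj f
  map φ := regradeMap f φ

/-- Transport of the grading along `f` as an equivalence. -/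
noncomputable def regradeEquiv (f : G ≃* G) : GVect k G ≌ GVect k G :=
  CategoryTheory.Equivalence.mk (regrade f) (regrade f.symm)
    (NatIso.ofComponents (fun V =>
      { hom := ⟨fun g => V.shift g (f.symm (f g))⟩
        inv := ⟨fun g => V.shift (f.symm (f g)) g⟩
        hom_inv_id := by
          ext g v; exact shift_shift V (f.symm_apply_apply g).symm v
        inv_hom_id := by
          ext g v; exact shift_shift V (f.symm_apply_apply g) v })
      fun φ => by ext g v; exact shift_natural φ _ _ v)
    (NatIso.ofComponents (fun V =>
      { hom := ⟨fun g => V.shift (f (f.symm g)) g⟩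
        inv := ⟨fun g => V.shift g (f (f.symm g))⟩
        hom_inv_id := by
          ext g v; exact shift_shift V (f.apply_symm_apply g) v
        inv_hom_id := by
          ext g v; exact shift_shift V (f.apply_symm_apply g).symm v })
      fun φ => by ext g v; exact shift_natural φ _ _ v)

/-- The identification of `V_a` with the component of degree `g` of the regraded object, for
`a = f⁻¹(g)`. -/
def regradeIn (f : G ≃* G) (V : GVect k G) {a g : G} (e : a = f.symm g) :
    V.comp a ≃ₗ[k] (regradeObj f V).comp g :=
  e ▸ LinearEquiv.refl k (V.comp a)

@[simp] theorem regradeMap_regradeIn (f : G ≃* G) {V W : GVect k G} (φ : V ⟶ W) {a g : G}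
    (e : a = f.symm g) (v : V.comp a) :
    Hom.app (regradeMap f φ) g (regradeIn f V e v) = regradeIn f W e (φ.app a v) := by
  subst e; rfl

theorem shift_regradeIn (f : G ≃* G) (V : GVect k G) {a b g h : G} (e : a = f.symm g)
    (e' : b = f.symm h) (v : V.comp a) :
    (regradeObj f V).shift g h (regradeIn f V e v) = regradeIn f V e' (V.shift a b v) := by
  by_cases hgh : g = h
  · subst hgh; subst e; subst e'; simp
  · have : a ≠ b := fun hab => hgh (f.symm.injective (by rw [← e, ← e', hab]))
    simp [shift_of_ne _ hgh, shift_of_ne _ this]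

theorem IsLine.regrade {V : GVect k G} {g : G} {v : V.comp g} (hv : IsLine V v) (f : G ≃* G)
    {h : G} (e : g = f.symm h) : IsLine (regradeObj f V) (regradeIn f V e v) := by
  subst e
  exact ⟨fun ha x => hv.eq_zero (fun h' => ha (f.symm.injective h')) x, hv.span, hv.ne_zero⟩

variable [Finite G]

/-- The tensorator of `regrade f` twisted by `κ`. -/
noncomputable def regradeTensor (f : G ≃* G) (κ : G → G → kˣ) (V W : GVect k G) :
    tensor (regradeObj f V) (regradeObj f W) ⟶ regradeObj f (tensor V W) :=
  ⟨fun _ => desc fun h l e => (κ h l : k) •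
    ((regradeIn f (tensor V W) (by rw [← map_mul, e])).toLinearMap ∘ₗ
      incl V W (f.symm h) (f.symm l) rfl ∘ₗ
      TensorProduct.map (regradeIn f V rfl).symm.toLinearMap
        (regradeIn f W rfl).symm.toLinearMap)⟩

@[simp] theorem regradeTensor_incl (f : G ≃* G) (κ : G → G → kˣ) (V W : GVect k G)
    {a b h l g : G} (ha : a = f.symm h) (hb : b = f.symm l) (e : h * l = g) (v : V.comp a)
    (w : W.comp b) :
    (regradeTensor f κ V W).app g (incl _ _ h l e (regradeIn f V ha v ⊗ₜ regradeIn f W hb w)) =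
      (κ h l : k) • regradeIn f (tensor V W) (by rw [ha, hb, ← map_mul, e])
        (incl V W a b rfl (v ⊗ₜ w)) := by
  subst ha hb
  simp [regradeTensor]

/-- The inverse of the tensorator. -/
noncomputable def regradeTensorInv (f : G ≃* G) (κ : G → G → kˣ) (V W : GVect k G) :
    regradeObj f (tensor V W) ⟶ tensor (regradeObj f V) (regradeObj f W) :=
  ⟨fun g => (desc fun a b e => (((κ (f a) (f b))⁻¹ : kˣ) : k) •
    (incl (regradeObj f V) (regradeObj f W) (f a) (f b)
      (by rw [← map_mul, e, f.apply_symm_apply]) ∘ₗ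
      TensorProduct.map (regradeIn f V (f.symm_apply_apply a).symm).toLinearMap
        (regradeIn f W (f.symm_apply_apply b).symm).toLinearMap)) ∘ₗ
    (regradeIn f (tensor V W) (a := f.symm g) rfl).symm.toLinearMap⟩

theorem regradeTensorInv_incl (f : G ≃* G) (κ : G → G → kˣ) (V W : GVect k G) {a b c g : G}
    (e : a * b = c) (hc : c = f.symm g) (v : V.comp a) (w : W.comp b) :
    (regradeTensorInv f κ V W).app g
      (regradeIn f (tensor V W) hc (incl V W a b e (v ⊗ₜ w))) =
      (((κ (f a) (f b))⁻¹ : kˣ) : k) • incl (regradeObj f V) (regradeObj f W) (f a) (f b)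
        (by rw [← map_mul, e, hc, f.apply_symm_apply])
        (regradeIn f V (f.symm_apply_apply a).symm v ⊗ₜ
          regradeIn f W (f.symm_apply_apply b).symm w) := by
  subst hc
  simp [regradeTensorInv]

theorem regradeIn_tensor_congr (f : G ≃* G) {V W : GVect k G} {a b c g : G} (e : a * b = c) (hc : c = f.symm g)
    (t : V.comp a ⊗[k] W.comp b) :
    regradeIn f (tensor V W) hc (incl V W a b e t) =
      regradeIn f (tensor V W) (e.trans hc) (incl V W a b rfl t) := by
  subst e; rfl

/-- The tensorator of `regrade f` twisted by `κ`, as an isomorphism. -/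
noncomputable def regradeTensorIso (f : G ≃* G) (κ : G → G → kˣ) (V W : GVect k G) :
    tensor (regradeObj f V) (regradeObj f W) ≅ regradeObj f (tensor V W) where
  hom := regradeTensor f κ V W
  inv := regradeTensorInv f κ V W
  hom_inv_id := hom_ext_tensor fun g h l e v w => by
    obtain ⟨a, rfl⟩ := f.surjective h
    obtain ⟨b, rfl⟩ := f.surjective l
    obtain ⟨v, rfl⟩ := (regradeIn f V (f.symm_apply_apply a).symm).surjective v
    obtain ⟨w, rfl⟩ := (regradeIn f W (f.symm_apply_apply b).symm).surjective w
    simp [regradeTensorInv_incl, smul_smul]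
  inv_hom_id := by
    ext g : 1
    -- Precomposing with `regradeIn` turns the source into a component of a tensor product, where
    -- `tensor_ext` applies.
    have : (Hom.app (regradeTensorInv f κ V W ≫ regradeTensor f κ V W) g) ∘ₗ
        (regradeIn f (tensor V W) (a := f.symm g) rfl).toLinearMap =
        (regradeIn f (tensor V W) (a := f.symm g) rfl).toLinearMap :=
      tensor_ext fun a b e v w => by
        simp [regradeTensorInv_incl, smul_smul, regradeIn_tensor_congr f e]
    ext x
    obtain ⟨x, rfl⟩ := (regradeIn f (tensor V W) (a := f.symm g) rfl).surjective x
    exact LinearMap.congr_fun this x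

section Monoidal

variable (f : G ≃* G) (κ : G → G → kˣ)

omit [Finite G] in
theorem regradeIn_surj (V : GVect k G) {g : G} (x : (regradeObj f V).comp g) :
    ∃ v : V.comp (f.symm g), x = regradeIn f V rfl v :=
  ⟨(regradeIn f V rfl).symm x, by simp⟩

theorem regradeTensor_naturality {V V' W W' : GVect k G} (φ : V ⟶ V') (φ' : W ⟶ W') :
    tensorMap (regradeMap f φ) (regradeMap f φ') ≫ regradeTensor f κ V' W' =
      regradeTensor f κ V W ≫ regradeMap f (tensorMap φ φ') :=
  hom_ext_tensor fun g h l e v w => by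
    obtain ⟨v', hv⟩ := regradeIn_surj f V v
    rw [hv]
    obtain ⟨w', hw⟩ := regradeIn_surj f W w
    rw [hw]
    simp

/-- On homogeneous vectors the two composites differ only by the two sides of the gauge relation, so
`κ` is a tensorator exactly because it relates the associators. The braiding is treated in the same
way. -/
theorem regradeTensor_associativity {ψ ψ' : G → G → G → kˣ}
    (h : ∀ g h l, κ g h * κ (g * h) l * ψ (f.symm g) (f.symm h) (f.symm l) =
      ψ' g h l * κ h l * κ g (h * l)) (X Y Z : GVect k G) :
    tensorMap (regradeTensor f κ X Y) (𝟙 (regradeObj f Z)) ≫ regradeTensor f κ (tensor X Y) Z ≫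
      regradeMap f (assocHom ψ X Y Z) =
    assocHom ψ' (regradeObj f X) (regradeObj f Y) (regradeObj f Z) ≫
      tensorMap (𝟙 (regradeObj f X)) (regradeTensor f κ Y Z) ≫ regradeTensor f κ X (tensor Y Z) :=
  hom_ext_tensor_left fun d a b c e x y z => by
    obtain ⟨x', hx⟩ := regradeIn_surj f X x
    rw [hx]
    obtain ⟨y', hy⟩ := regradeIn_surj f Y y
    rw [hy]
    obtain ⟨z', hz⟩ := regradeIn_surj f Z z
    rw [hz]
    have := congrArg Units.val (h a b c)
    simp only [Units.val_mul] at this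
    simp [← TensorProduct.smul_tmul', smul_smul]
    rw [this, regradeIn_tensor_congr]

theorem regradeTensor_braided {Ω Ω' : G → G → kˣ}
    (h : ∀ g h, κ g h * Ω (f.symm h) (f.symm g) = Ω' h g * κ h g) (X Y : GVect k G) :
    regradeTensor f κ X Y ≫ regradeMap f (braidHom Ω X Y) =
      braidHom Ω' (regradeObj f X) (regradeObj f Y) ≫ regradeTensor f κ Y X :=
  hom_ext_tensor fun d a b e x y => by
    obtain ⟨x', hx⟩ := regradeIn_surj f X x
    rw [hx]
    obtain ⟨y', hy⟩ := regradeIn_surj f Y y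
    rw [hy]
    have := congrArg Units.val (h a b)
    simp only [Units.val_mul] at this
    simp [smul_smul, this]
    rw [regradeIn_tensor_congr]

omit [Finite G] in
/-- A unit comparison for `regrade f`. -/
theorem exists_regradeUnit : ∃ ε : simple (k := k) (1 : G) ≅ regradeObj f (simple 1),
    ε.hom.app 1 (simpleOne 1) = regradeIn f (simple 1) (map_one f.symm).symm (simpleOne 1) :=
  ((isLine_simple 1).regrade f (map_one f.symm).symm).exists_iso

theorem regradeTensor_left_unitality (hκ : ∀ g, κ 1 g = 1)
    {ε : simple (k := k) (1 : G) ⟶ regradeObj f (simple 1)} (hε : ε.app 1 (simpleOne 1) =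
      regradeIn f (simple 1) (map_one f.symm).symm (simpleOne 1)) (X : GVect k G) :
    leftUnitHom (regradeObj f X) = tensorMap ε (𝟙 (regradeObj f X)) ≫
      regradeTensor f κ (simple 1) X ≫ regradeMap f (leftUnitHom X) :=
  hom_ext_tensor fun g h l e s x => by
    by_cases hh : h = 1
    · subst hh
      rw [simple_eq_smul s]
      obtain ⟨x', hx⟩ := regradeIn_surj f X x
      rw [hx]
      simp [← TensorProduct.smul_tmul', hε, hκ]
      rw [shift_regradeIn f X _ (by rw [← e, map_mul, map_one])]
    · simp [simple_eq_zero hh s]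

theorem regradeTensor_right_unitality (hκ : ∀ g, κ g 1 = 1)
    {ε : simple (k := k) (1 : G) ⟶ regradeObj f (simple 1)} (hε : ε.app 1 (simpleOne 1) =
      regradeIn f (simple 1) (map_one f.symm).symm (simpleOne 1)) (X : GVect k G) :
    rightUnitHom (regradeObj f X) = tensorMap (𝟙 (regradeObj f X)) ε ≫
      regradeTensor f κ X (simple 1) ≫ regradeMap f (rightUnitHom X) :=
  hom_ext_tensor fun g h l e x s => by
    by_cases hl : l = 1
    · subst hl
      rw [simple_eq_smul s]
      obtain ⟨x', hx⟩ := regradeIn_surj f X x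
      rw [hx]
      simp [hε, hκ]
      rw [shift_regradeIn f X _ (by rw [← e, map_mul, map_one])]
    · simp [simple_eq_zero hl s]

end Monoidal

end GVect

/-! ### Equivalences of weak ribbon structures versus automorphisms of the group -/

variable {k G : Type u} [Field k] [CommGroup G] [Finite G]

namespace WRMS

/-- The weak ribbon structure `(α_ψ, γ_Ω, θ_t, p)`. -/
noncomputable def ofFun {ψ : G → G → G → kˣ} {Ω : G → G → kˣ} {t : G → kˣ} {p : G}
    (h : (RibbonData.ofFun ψ Ω t p).IsWeakRibbon) : WRMS k G :=
  ⟨_, h⟩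

/-- Regrading along `f` gives an equivalence between weak ribbon structures whose cocycles are
cohomologous along `f`. -/
theorem equivalent_of_gauge {ψ ψ' : G → G → G → kˣ} {Ω Ω' : G → G → kˣ} {t t' : G → kˣ} {p p' : G}
    (hD : (RibbonData.ofFun ψ Ω t p).IsWeakRibbon)
    (hD' : (RibbonData.ofFun ψ' Ω' t' p').IsWeakRibbon) (f : G ≃* G) (κ : G → G → kˣ)
    (hκl : ∀ g, κ 1 g = 1) (hκr : ∀ g, κ g 1 = 1)
    (hψ : ∀ g h l, κ g h * κ (g * h) l * ψ (f.symm g) (f.symm h) (f.symm l) =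
      ψ' g h l * κ h l * κ g (h * l))
    (hΩ : ∀ g h, κ g h * Ω (f.symm h) (f.symm g) = Ω' h g * κ h g)
    (ht : ∀ g, t g = t' (f g)) (hp : f p = p') :
    Equivalent (ofFun hD) (ofFun hD') := by
  let S : WRMS k G := ofFun hD
  let S' : WRMS k G := ofFun hD'
  let e : S.Cat ≌ S'.Cat := GVect.regradeEquiv f
  obtain ⟨ε, hε⟩ := GVect.exists_regradeUnit (k := k) f
  let M : e.functor.CoreMonoidal :=
    { εIso := ε
      μIso := fun X Y => GVect.regradeTensorIso f κ X Y
      μIso_hom_natural_left := fun φ X => GVect.regradeTensor_naturality f κ φ (𝟙 X)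
      μIso_hom_natural_right := fun X φ => GVect.regradeTensor_naturality f κ (𝟙 X) φ
      associativity := fun X Y Z => GVect.regradeTensor_associativity f κ hψ X Y Z
      left_unitality := fun X => GVect.regradeTensor_left_unitality f κ hκl hε X
      right_unitality := fun X => GVect.regradeTensor_right_unitality f κ hκr hε X }
  let B : e.functor.Braided :=
    { M.toMonoidal with
      braided := fun X Y => GVect.regradeTensor_braided f κ hΩ X Y }
  refine ⟨e, ⟨rfl⟩, ⟨fun _ _ => rfl⟩, ⟨B⟩, fun g => ?_, ?_⟩
  · refine GVect.hom_ext fun h => ?_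
    change (t (f.symm h) : k) • LinearMap.id = (t' h : k) • LinearMap.id
    rw [ht, f.apply_symm_apply]
    rfl
  · obtain ⟨φ, -⟩ := ((GVect.isLine_simple (k := k) p).regrade f
      (h := p') (by rw [← hp, f.symm_apply_apply])).exists_iso
    exact ⟨φ.symm⟩

/-- The underlying isomorphism of graded vector spaces. -/
def isoOfCat {S : WRMS k G} {X Y : S.Cat} (φ : X ≅ Y) :
    (show GVect k G from X) ≅ (show GVect k G from Y) := φ

/-- An equivalence of weak ribbon structures induces an automorphism of `G`. -/
theorem Equivalent.exists_mulEquiv {ψ ψ' : G → G → G → kˣ} {Ω Ω' : G → G → kˣ} {t t' : G → kˣ}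
    {p p' : G} (hD : (RibbonData.ofFun ψ Ω t p).IsWeakRibbon)
    (hD' : (RibbonData.ofFun ψ' Ω' t' p').IsWeakRibbon)
    (H : Equivalent (ofFun hD) (ofFun hD')) :
    ∃ f : G ≃* G, (∀ g, t g = t' (f g)) ∧ f p = p' := by
  obtain ⟨e, hadd, hlin, ⟨B⟩, htw, ⟨i⟩⟩ := H
  let S : WRMS k G := ofFun hD
  let S' : WRMS k G := ofFun hD'
  let F : S.Cat ⥤ S'.Cat := e.functor
  have : F.Additive := hadd
  have : F.Linear k := hlin
  let : F.Braided := B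
  have : F.IsEquivalence := inferInstanceAs e.functor.IsEquivalence
  let F' : GVect k G → GVect k G := fun V => F.obj V
  have hline : ∀ g : G, ∃ (h : G) (v : (F' (GVect.simple g)).comp h),
      GVect.IsLine (F' (GVect.simple g)) v := fun g => by
    -- `F` is linear and fully faithful, so the endomorphisms of the image of `k_g` are scalars, as
    -- those of `k_g` are.
    refine GVect.exists_isLine_of_end _ (fun h0 => ?_) fun φ => ?_
    · have : F.map (𝟙 (S.simple g)) = F.map (0 : S.simple g ⟶ S.simple g) :=
        (F.map_id _).trans (Eq.trans h0 (F.map_zero _ _).symm)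
      have := F.map_injective this
      refine (GVect.isLine_simple (k := k) g).ne_zero ?_
      exact congrArg (fun φ : GVect.simple g ⟶ GVect.simple g => φ.app g (GVect.simpleOne g)) this
    · obtain ⟨χ, rfl⟩ : ∃ χ : S.simple g ⟶ S.simple g, F.map χ = φ := F.map_surjective _
      obtain ⟨r, hr⟩ := (GVect.isLine_simple (k := k) g).span
        (GVect.Hom.app (V := GVect.simple g) (W := GVect.simple g) χ g (GVect.simpleOne g))
      have hχ : χ = r • 𝟙 (S.simple g) := (GVect.isLine_simple (k := k) g).hom_ext hr
      refine ⟨r, ?_⟩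
      rw [hχ]
      refine (F.map_smul r _).trans ?_
      exact congrArg (r • ·) (F.map_id _)
  -- The automorphism sends `g` to the degree of the line `F(k_g)`. The tensorator makes it
  -- multiplicative, and reflection of isomorphisms makes it injective.
  choose f v hf using hline
  have hiso : ∀ g h : G, Nonempty (F' (GVect.simple g) ≅ F' (GVect.simple h)) → g = h := by
    rintro g h ⟨φ⟩
    exact (GVect.isLine_simple g).degree_eq (GVect.isLine_simple h)
      (isoOfCat (F.preimageIso (X := S.simple g) (Y := S.simple h) φ))
  have hmul : ∀ g h, f (g * h) = f g * f h := fun g h => by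
    obtain ⟨φ, -⟩ := ((GVect.isLine_simple (k := k) g).tensor (GVect.isLine_simple h) rfl).exists_iso
    let φ₁ : S.simple (g * h) ≅ S.simple g ⊗ S.simple h := φ
    let φ₂ := F.mapIso φ₁ ≪≫ (Functor.Monoidal.μIso F (S.simple g) (S.simple h)).symm
    exact (hf (g * h)).degree_eq ((hf g).tensor (hf h) rfl) (isoOfCat φ₂)
  have hinj : Function.Injective f := fun g h hgh => by
    obtain ⟨φ, -⟩ := (hf g).exists_iso
    obtain ⟨χ, -⟩ := (hf h).exists_iso
    refine hiso g h ⟨φ.symm ≪≫ eqToIso (by rw [hgh]) ≪≫ χ⟩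
  let f' : G ≃* G := MulEquiv.ofBijective (MonoidHom.mk' f hmul)
    (Finite.injective_iff_bijective.mp hinj)
  refine ⟨f', fun g => Units.ext ?_, ?_⟩
  -- The scalar by which the twist acts on `k_g` survives `F` by linearity, and is read off on the
  -- spanning vector in degree `f g`.
  · refine (hf g).smul_injective ?_
    have h₁ : S.twist (S.simple g) = (t g : k) • 𝟙 (S.simple g) :=
      (GVect.isLine_simple (k := k) g).hom_ext rfl
    have h₂ := htw g
    rw [h₁] at h₂
    have h₃ : (t g : k) • 𝟙 (F.obj (S.simple g)) = S'.twist (F.obj (S.simple g)) :=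
      Eq.trans ((congrArg (_ • ·) (F.map_id _).symm).trans (F.map_smul _ _).symm) h₂
    exact congrArg (fun φ : F' (GVect.simple g) ⟶ F' (GVect.simple g) => φ.app (f g) (v g)) h₃
  · exact (hf p).degree_eq (GVect.isLine_simple p') (isoOfCat i)

end WRMS

/-! ### The bijection -/

theorem mainTheorem1 {k G : Type u} [Field k] [CommGroup G] [Finite G]
    (hG : ∀ g : G, ∃ h : G, h * h = g) :
    ∃ Φ : Quotient (WRQF.setoid k G) → Quotient (WRMS.setoid k G),
      Function.Bijective Φ ∧
      ∀ x : WRQF k G,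
        (∃ c : AbelianCocycle k G, c.emImage = x.q.toFun) ∧
        ∀ c : AbelianCocycle k G, c.emImage = x.q.toFun →
          ∃ h : (RibbonData.of c x.total (x.pt ^ (-2 : ℤ))).IsWeakRibbon,
            Φ ⟦x⟧ = ⟦⟨RibbonData.of c x.total (x.pt ^ (-2 : ℤ)), h⟩⟧ := by
  -- Allowing different representatives and different cocycles at once settles both independence
  -- claims; the case `x = y` compares cocycles.
  have key : ∀ (x y : WRQF k G) (c c' : AbelianCocycle k G) (hc : c.emImage = x.q.toFun)
      (hc' : c'.emImage = y.q.toFun), x ≈ y →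
      (⟦⟨_, RibbonData.of_isWeakRibbon hG c hc⟩⟧ : Quotient (WRMS.setoid k G)) =
        ⟦⟨_, RibbonData.of_isWeakRibbon hG c' hc'⟩⟧ := by
    rintro x y c c' hc hc' ⟨f, hf, hp⟩
    obtain ⟨κ, h₁, h₂, h₃, h₄⟩ := c.exists_gauge hG c' f fun g => by
      rw [hc, hc']
      exact WRQF.q_eq_of_total_eq hG f hf g
    exact Quotient.sound (WRMS.equivalent_of_gauge (RibbonData.of_isWeakRibbon hG c hc)
      (RibbonData.of_isWeakRibbon hG c' hc') f κ h₁ h₂ h₃ h₄ hf (by rw [map_zpow, hp]))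
  choose c hc using fun x : WRQF k G => x.q.exists_cocycle hG
  refine ⟨Quotient.lift (fun x => ⟦⟨_, RibbonData.of_isWeakRibbon hG (c x) (hc x)⟩⟧)
    fun x y => key x y _ _ (hc x) (hc y), ⟨?_, ?_⟩, fun x => ⟨x.q.exists_cocycle hG,
      fun c' hc' => ⟨RibbonData.of_isWeakRibbon hG c' hc', key x x _ _ (hc x) hc'
        (Setoid.refl x)⟩⟩⟩
  · rintro ⟨x⟩ ⟨y⟩ hxy
    obtain ⟨f, hf, hp⟩ := WRMS.Equivalent.exists_mulEquiv
      (RibbonData.of_isWeakRibbon hG (c x) (hc x)) (RibbonData.of_isWeakRibbon hG (c y) (hc y))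
      (Quotient.exact hxy)
    refine Quotient.sound ⟨f, hf, ?_⟩
    -- The equivalence only gives `f(g₀)⁻² = g₀'⁻²`; applying the square root homomorphism recovers
    -- `f(g₀) = g₀'`.
    obtain ⟨s, hs⟩ := exists_sqrt_hom hG
    rw [map_zpow, zpow_neg, zpow_neg, inv_inj, zpow_two, zpow_two] at hp
    have := congrArg s hp
    rw [map_mul, map_mul, hs, hs] at this
    exact this
  · rintro ⟨D, hD⟩
    obtain ⟨x, c', hc', rfl⟩ := hD.exists_eq_of hG
    exact ⟨⟦x⟧, key x x _ _ (hc x) hc' (Setoid.refl x)⟩
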